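/- **Setting.** A preference order (vote) over a finite nonempty set $C$ is a linear order on $C$; $\mathrm{pos}_v(c)\in\{1,\dots,|C|\}$ is the position of $c$ in $v$, the top position being $1$. The Spearman distance of two votes $u,v$ over $C$ is $d_{\mathrm{Spear}}(u,v)=\sum_{c\in C}|\mathrm{pos}_v(c)-\mathrm{pos}_u(c)|$; the swap distance $d_{\mathrm{swap}}(u,v)$ is the smallest number of swaps of candidates on consecutive positions that transform $u$ into $v$. An election $E=(C,V)$ consists of a finite nonempty candidate set $C$ and a sequence $V=(v_1,\dots,v_n)$ of votes over $C$. For a distance $d$ on votes and two elections $E=(C,(v_1,\dots,v_n))$, $E'=(C',(v'_1,\dots,v'_n))$ with $|C|=|C'|$, the $d$-isomorphic distance is $$d\text{-ID}(E,E')=\min_{\nu\in S_n}\ \min_{\sigma\colon C\to C'\text{ bijective}}\ \sum_{i=1}^n d\bigl(\sigma(v_i),v'_{\nu(i)}\bigr),$$ where $\sigma(v)$ is the vote over $C'$ that arises from $v$ by renaming candidates along $\sigma$. In the optimization problem $d$-ID one is given two such elections (all votes listed explicitly) and is asked for the number $d\text{-ID}(E,E')$. For a function $\rho$, a polynomial-time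 $\rho(|C|)$-approximation algorithm for $d$-ID is a deterministic polynomial-time algorithm (Turing machine) that on every instance $(E,E')$ outputs a number $x\in\mathbb N$ with $$d\text{-ID}(E,E')\le x\le \rho(|C|)\cdot d\text{-ID}(E,E').$$ Graph Isomorphism is the problem of deciding whether two given finite simple undirected graphs are isomorphic. **Theorem.** Let $\alpha<1$ be a real number. If Graph Isomorphism is not in $\mathrm P$, then there is no polynomial-time $|C|^{\alpha}$-approximation algorithm for $d_{\mathrm{Spear}}$-ID, and there is no polynomial-time $|C|^{\alpha}$-approximation algorithm for $d_{\mathrm{swap}}$-ID. -/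

import Mathlib

noncomputable section

namespace ElectionIso

open Turing Computability

/-! ### Preference orders and distances between them -/

/-- A preference order over a set `C` of `m` candidates, given by its position function: `v c` is
the position of the candidate `c` in the vote `v`, where position `0` is the top one. (Linear orders
over a finite set and bijections with `{0, …, m - 1}` are the same thing, see
`existsUnique_prefOrder`.) -/
abbrev PrefOrder (C : Type*) (m : ℕ) := C ≃ Fin m

/-- The vote `v` ranks `a` higher than `b`. -/
def PrefOrder.Prefers {C : Type*} {m : ℕ} (v : PrefOrder C m) (a b : C) : Prop := v a < v b

/-- Every strict linear order over a set of `m` candidates is the order of exactly one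
`PrefOrder`. -/
theorem existsUnique_prefOrder {C : Type*} [Fintype C] {m : ℕ} (hm : Fintype.card C = m)
    (r : C → C → Prop) [IsStrictTotalOrder C r] :
    ∃! v : PrefOrder C m, ∀ a b, v.Prefers a b ↔ r a b := by
  classical
  let _ : LinearOrder C := linearOrderOfSTO r
  let e : Fin m ≃o C := Fintype.orderIsoFinOfCardEq C hm
  refine ⟨e.symm.toEquiv, fun a b => e.symm.lt_iff_lt, fun w hw => ?_⟩
  have hw' : ∀ a b : C, w a < w b ↔ a < b := hw
  let w' : C ≃o Fin m :=
    ⟨w, fun {a b} => by rw [← not_lt, ← not_lt]; exact not_congr (hw' b a)⟩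
  have : w' = e.symm := Subsingleton.elim _ _
  exact congrArg RelIso.toEquiv this

/-- The preference order `σ(v)` obtained from `v` by renaming the candidates along `σ`. -/
def PrefOrder.rename {C D : Type*} {m : ℕ} (σ : C ≃ D) (v : PrefOrder C m) : PrefOrder D m :=
  σ.symm.trans v

theorem PrefOrder.rename_prefers {C D : Type*} {m : ℕ} (σ : C ≃ D) (v : PrefOrder C m) (a b : C) :
    (v.rename σ).Prefers (σ a) (σ b) ↔ v.Prefers a b := by
  simp [PrefOrder.rename, PrefOrder.Prefers]

/-- Spearman's footrule: the total displacement of the candidates. -/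
def spearDist {C : Type*} [Fintype C] {m : ℕ} (u v : PrefOrder C m) : ℕ :=
  ∑ c : C, (((v c : ℕ) : ℤ) - ((u c : ℕ) : ℤ)).natAbs

/-- `v` arises from `u` by swapping the two candidates on some two consecutive positions. -/
def IsAdjacentSwap {C : Type*} {m : ℕ} (u v : PrefOrder C m) : Prop :=
  ∃ i j : Fin m, (i : ℕ) + 1 = (j : ℕ) ∧ v = u.trans (Equiv.swap i j)

/-- `u` can be transformed into `v` with exactly `k` swaps of consecutive candidates. -/
def SwapReach {C : Type*} {m : ℕ} : ℕ → PrefOrder C m → PrefOrder C m → Prop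
  | 0, u, v => u = v
  | k + 1, u, v => ∃ w, IsAdjacentSwap u w ∧ SwapReach k w v

/-- The swap distance: the smallest number of swaps of consecutive candidates that transform `u`
into `v`. -/
def swapDist {C : Type*} {m : ℕ} (u v : PrefOrder C m) : ℕ :=
  sInf {k : ℕ | SwapReach k u v}

/-- The set in the definition of `swapDist` is never empty. -/
theorem exists_swapReach {C : Type*} {m : ℕ} (u v : PrefOrder C m) : ∃ k, SwapReach k u v := by
  have key : ∀ p : Equiv.Perm (Fin m), ∀ u : PrefOrder C m, ∃ k, SwapReach k u (u.trans p) := by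
    intro p
    cases m with
    | zero => exact fun u => ⟨0, Equiv.ext fun c => (u c).elim0⟩
    | succ m =>
      have hp : p ∈ Submonoid.closure
          (Set.range fun i : Fin m => Equiv.swap i.castSucc i.succ) := by
        rw [Equiv.Perm.mclosure_swap_castSucc_succ]; trivial
      induction hp using Submonoid.closure_induction_right with
      | one => exact fun u => ⟨0, rfl⟩
      | mul_right x _ y hy ih =>
        intro u
        obtain ⟨i, rfl⟩ := hy
        obtain ⟨k, hk⟩ := ih (u.trans (Equiv.swap i.castSucc i.succ))
        exact ⟨k + 1, _, ⟨i.castSucc, i.succ, by simp, rfl⟩, hk⟩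
  obtain ⟨k, hk⟩ := key (u.symm.trans v) u
  refine ⟨k, ?_⟩
  rwa [← Equiv.trans_assoc, Equiv.self_trans_symm, Equiv.refl_trans] at hk

/-! ### Elections and isomorphic distances -/

/-- An election with candidate set `C` of `m` elements and `n` voters. -/
abbrev Election (C : Type*) (m n : ℕ) := Fin n → PrefOrder C m

/-- The `d`-isomorphic distance of two elections: the minimum, over all voter matchings `ν` and all
candidate matchings `σ`, of `∑ i, d (σ (v i)) (v' (ν i))`. -/
def isoDist {C D : Type*} {m n : ℕ} (d : PrefOrder D m → PrefOrder D m → ℕ)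
    (E : Election C m n) (E' : Election D m n) : ℕ :=
  ⨅ p : Equiv.Perm (Fin n) × (C ≃ D), ∑ i : Fin n, d ((E i).rename p.2) (E' (p.1 i))

/-! ### Encodings of instances as bit strings -/

/-- Self-delimiting unary code of a number. -/
def unary (k : ℕ) : List Bool := List.replicate k true ++ [false]

/-- An instance of the (optimization) problem `d`-ID: two elections with the same number `m ≥ 1` of
candidates, which are called `0, …, m - 1`, and the same number `n` of voters. -/
structure IDInstance where
  /-- the number of candidates -/
  m : ℕ
  /-- the number of voters -/
  n : ℕ
  m_pos : 0 < m
  /-- the first election -/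
  E : Election (Fin m) m n
  /-- the second election -/
  E' : Election (Fin m) m n

/-- The votes one after the other, each as the list of its candidates from top to bottom. (Since
all votes are listed in full, writing the candidates' numbers in unary or in binary leads to input
lengths that are polynomially related.) -/
def encodeElection {m n : ℕ} (E : Election (Fin m) m n) : List Bool :=
  (List.finRange n).flatMap fun i => (List.finRange m).flatMap fun j => unary ((E i).symm j)

/-- The bit string that an algorithm for `d`-ID gets as its input. -/
def IDInstance.encode (I : IDInstance) : List Bool :=
  unary I.m ++ unary I.n ++ encodeElection I.E ++ encodeElection I.E'

/-- An instance of Graph Isomorphism: two finite simple undirected graphs. -/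
structure GIInstance where
  /-- the number of vertices of the first graph -/
  n : ℕ
  /-- the first graph -/
  G : SimpleGraph (Fin n)
  /-- the number of vertices of the second graph -/
  n' : ℕ
  /-- the second graph -/
  G' : SimpleGraph (Fin n')

open Classical in
/-- The number of vertices in unary, followed by the adjacency matrix, row by row. -/
def encodeGraph {n : ℕ} (G : SimpleGraph (Fin n)) : List Bool :=
  unary n ++ (List.finRange n).flatMap fun i => (List.finRange n).map fun j => decide (G.Adj i j)

/-- The bit string that an algorithm for Graph Isomorphism gets as its input. -/
def GIInstance.encode (I : GIInstance) : List Bool :=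
  encodeGraph I.G ++ encodeGraph I.G'

/-! ### Polynomial-time algorithms -/

/-- There is a polynomial-time `ρ(|C|)`-approximation algorithm for the problem of computing the
`d`-isomorphic distance: a polynomial-time Turing machine that, given (the encoding of) an instance,
outputs in binary a number `A I` which lies between the distance and `ρ(|C|)` times the
distance. -/
def HasPolyTimeApprox (d : ∀ m : ℕ, PrefOrder (Fin m) m → PrefOrder (Fin m) m → ℕ)
    (ρ : ℕ → ℝ) : Prop :=
  ∃ A : IDInstance → ℕ,
    Nonempty (TM2ComputableInPolyTime IDInstance.encode encodeNat A) ∧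
    ∀ I : IDInstance,
      isoDist (d I.m) I.E I.E' ≤ A I ∧ (A I : ℝ) ≤ ρ I.m * (isoDist (d I.m) I.E I.E' : ℝ)

open Classical in
/-- Graph Isomorphism is in P: a polynomial-time Turing machine decides whether two given graphs are
isomorphic. -/
def GraphIsomorphismInP : Prop :=
  Nonempty (TM2ComputableInPolyTime GIInstance.encode encodeBool
    fun I : GIInstance => decide (Nonempty (I.G ≃g I.G')))

end ElectionIso

end

/-! An approximation within `|C| ^ α` would separate two families of instances whose distances
differ by more than that factor; the reduction builds such instances from pairs of graphs.

From a graph on `n` vertices, build `n + 2` votes over `3 * (n + t)` candidates, arranged as three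
blocks of `n + t`. In each block the first `n` candidates stand for the vertices and the other `t`
are fillers. The vote of vertex `i` starts from the standard order, exchanges the block-0 and
block-2 copies of `i`, and exchanges the block-0 and block-1 copies of each neighbour of `i`. The
last two votes leave the order unchanged. Thus the votes record the adjacency matrix, and a vertex
candidate placed in the wrong block is displaced by more than `t`.

If the graphs are isomorphic, the isomorphism matches voters and vertex candidates so that only
pairs among the `3 * n` vertex candidates can be inverted; the distance is at most `18 * (n + 2) ^
3`, whatever `t` is (`exists_card_inversions_le`). Conversely, a matching of total Spearman cost
below `t` puts every block-0 vertex candidate in the right block in every vote, which forces an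
isomorphism (`exists_perm_of_sum_lt`). Both distances are handled at once, since Spearman distance
is at most twice swap distance, and swap distance is at most the number of inversions
(`isoDist_graphElection`).

With `t` about `n ^ e`, the number of candidates is about `t`, and `|C| ^ α * 18 * (n + 2) ^ 3 < t /
2` once `e` is large compared with `1 / (1 - α)` (`exists_exponent`). Hence the approximate value,
compared with `t / 2`, decides isomorphism.

To obtain an actual Turing machine, programs over stacks of bits with an oracle command are compiled
to `TM2` machines that contain the approximation machine (`Exec.steps`). The predicates `PT` and
`PD`, closed under arithmetic, bounded quantification, concatenation and oracle calls, then yield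
the polynomial-time bounds compositionally. -/

noncomputable section

/-! ### Oracle programs and their compilation to Turing machines. -/

namespace StackProgram

open Turing Computability StateTransition

/-! ### Structured programs over stacks of bits -/

/-- Programs over a family `K` of stacks of bits. The command `call i o` consults an oracle. -/
inductive Cmd (K : Type) : Type
  | skip : Cmd K
  | push (k : K) (b : Bool) : Cmd K
  | seq (c d : Cmd K) : Cmd K
  /-- pop `k` and branch -/
  | case (k : K) (onNil onFalse onTrue : Cmd K) : Cmd K
  /-- pop `k` until it is empty, running a body for each bit -/
  | loop (k : K) (onFalse onTrue : Cmd K) : Cmd K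
  | call (i o : K) : Cmd K

/-- Renaming of the stacks of a program. -/
def Cmd.map {K K' : Type} (κ : K → K') : Cmd K → Cmd K'
  | skip => skip
  | push k b => push (κ k) b
  | seq c d => seq (c.map κ) (d.map κ)
  | case k a b c => case (κ k) (a.map κ) (b.map κ) (c.map κ)
  | loop k a b => loop (κ k) (a.map κ) (b.map κ)
  | call i o => call (κ i) (κ o)

/-- `Exec R c S S' t`: started with the contents `S` of the stacks, the program `c` ends with the
contents `S'` after at most `t` units of time, where the oracle answers according to `R`. -/
inductive Exec {K : Type} (R : List Bool → List Bool → ℕ → Prop) :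
    Cmd K → (K → List Bool) → (K → List Bool) → ℕ → Prop
  | skip {S : K → List Bool} : Exec R .skip S S 1
  | push {S S' : K → List Bool} {k : K} {b : Bool} (h : S' k = b :: S k)
      (h' : ∀ j, j ≠ k → S' j = S j) : Exec R (.push k b) S S' 1
  | seq {S S₁ S₂ : K → List Bool} {c d : Cmd K} {s t : ℕ} (h : Exec R c S S₁ s)
      (h' : Exec R d S₁ S₂ t) : Exec R (.seq c d) S S₂ (s + t)
  | case_nil {S S' : K → List Bool} {k : K} {a b c : Cmd K} {t : ℕ} (h : S k = [])
      (h' : Exec R a S S' t) : Exec R (.case k a b c) S S' (t + 1)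
  | case_cons {S S₁ S' : K → List Bool} {k : K} {a b c : Cmd K} {t : ℕ} (x : Bool)
      (h : S k = x :: S₁ k) (h₁ : ∀ j, j ≠ k → S₁ j = S j)
      (h' : Exec R (cond x c b) S₁ S' t) : Exec R (.case k a b c) S S' (t + 1)
  | loop_nil {S : K → List Bool} {k : K} {a b : Cmd K} (h : S k = []) : Exec R (.loop k a b) S S 1
  | loop_cons {S S₁ S₂ S' : K → List Bool} {k : K} {a b : Cmd K} {s t : ℕ} (x : Bool)
      (h : S k = x :: S₁ k) (h₁ : ∀ j, j ≠ k → S₁ j = S j) (h₂ : Exec R (cond x b a) S₁ S₂ s)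
      (h' : Exec R (.loop k a b) S₂ S' t) : Exec R (.loop k a b) S S' (1 + s + t)
  -- Query and answer are stored reversed because copying between stacks, one bit at a time,
  -- reverses a word. Each of the two copying loops spends one extra step on finding its stack
  -- empty, hence the `+ 2`.
  | call {S S' : K → List Bool} {i o : K} {u v : List Bool} {t : ℕ} (hio : i ≠ o)
      (h : R u v t) (hi : S i = u.reverse) (hi' : S' i = []) (ho : S' o = v.reverse ++ S o)
      (h' : ∀ j, j ≠ i → j ≠ o → S' j = S j) :
      Exec R (.call i o) S S' (u.length + t + v.length + 2)
  | weaken {S S' : K → List Bool} {c : Cmd K} {s t : ℕ} (h : Exec R c S S' s) (hst : s ≤ t) :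
      Exec R c S S' t

variable {K K' : Type} {R : List Bool → List Bool → ℕ → Prop}

/-- A renamed program acts on the renamed stacks only. -/
theorem Exec.map {κ : K → K'} (hκ : Function.Injective κ) {c : Cmd K} {S S' : K → List Bool}
    {t : ℕ} (h : Exec R c S S' t) {T T' : K' → List Bool} (hT : ∀ k, T (κ k) = S k)
    (hT' : ∀ k, T' (κ k) = S' k) (hTT : ∀ j, (∃ k, κ k = j) ∨ T' j = T j) :
    Exec R (c.map κ) T T' t := by
  -- The intermediate stores of the derivation have no given counterparts over `K'`. Extending all
  -- of them by one fixed background `B` supplies these, so that the induction goes through.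
  have key : ∀ B : K' → List Bool,
      Exec R (c.map κ) (Function.extend κ S B) (Function.extend κ S' B) t := by
    intro B
    have frame : ∀ (S S₁ : K → List Bool) (k : K), (∀ j, j ≠ k → S₁ j = S j) → ∀ j, j ≠ κ k →
        Function.extend κ S₁ B j = Function.extend κ S B j := by
      intro S S₁ k h j hj
      by_cases hx : ∃ a, κ a = j
      · obtain ⟨a, rfl⟩ := hx
        rw [hκ.extend_apply, hκ.extend_apply]
        exact h a fun e => hj (e ▸ rfl)
      · rw [Function.extend_apply' _ _ _ hx, Function.extend_apply' _ _ _ hx]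
    clear hT hT'
    induction h with
    | skip => exact .skip
    | push h h' =>
      exact .push (by simpa only [hκ.extend_apply] using h) (frame _ _ _ h')
    | seq _ _ ih ih' => exact .seq ih ih'
    | case_nil h _ ih => exact .case_nil (by simpa only [hκ.extend_apply] using h) ih
    | case_cons x h h₁ _ ih =>
      refine .case_cons x (by simpa only [hκ.extend_apply] using h) (frame _ _ _ h₁) ?_
      cases x <;> exact ih
    | loop_nil h => exact .loop_nil (by simpa only [hκ.extend_apply] using h)
    | loop_cons x h h₁ _ _ ih ih' =>
      refine .loop_cons x (by simpa only [hκ.extend_apply] using h) (frame _ _ _ h₁) ?_ ih'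
      cases x <;> exact ih
    | @call S S' i o u v t hio h hi hi' ho h' =>
      refine .call (hκ.ne hio) h (by simpa only [hκ.extend_apply] using hi)
        (by simpa only [hκ.extend_apply] using hi') (by simpa only [hκ.extend_apply] using ho) ?_
      intro j hj hj'
      by_cases hx : ∃ a, κ a = j
      · obtain ⟨a, rfl⟩ := hx
        rw [hκ.extend_apply, hκ.extend_apply]
        exact h' a (fun e => hj (e ▸ rfl)) fun e => hj' (e ▸ rfl)
      · rw [Function.extend_apply' _ _ _ hx, Function.extend_apply' _ _ _ hx]
    | weaken _ hst ih => exact .weaken ih hst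
  have e : T = Function.extend κ S T := by
    funext j
    by_cases hx : ∃ a, κ a = j
    · obtain ⟨a, rfl⟩ := hx
      rw [hκ.extend_apply, hT]
    · rw [Function.extend_apply' _ _ _ hx]
  have e' : T' = Function.extend κ S' T := by
    funext j
    by_cases hx : ∃ a, κ a = j
    · obtain ⟨a, rfl⟩ := hx
      rw [hκ.extend_apply, hT']
    · rw [Function.extend_apply' _ _ _ hx]
      exact (hTT j).resolve_left hx
  rw [e, e']
  simpa only using key T

/-! ### Compilation to Turing machines -/

/-- The labels that a compiled program needs; `L` are the labels of the oracle machine. -/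
def Cmd.Lab (L : Type) : Cmd K → Type
  | skip => Unit
  | push _ _ => Unit
  | seq c d => c.Lab L ⊕ d.Lab L
  | case _ a b c => Option (a.Lab L ⊕ b.Lab L ⊕ c.Lab L)
  | loop _ a b => Option (a.Lab L ⊕ b.Lab L)
  -- `none` copies the query in, `some none` copies the answer out, and `some (some l)` is the label
  -- `l` of the oracle.
  | call _ _ => Option (Option L)

instance Cmd.fintypeLab (L : Type) [Fintype L] : (c : Cmd K) → Fintype (c.Lab L)
  | skip => inferInstanceAs (Fintype Unit)
  | push _ _ => inferInstanceAs (Fintype Unit)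
  | seq c d =>
    have := fintypeLab L c
    have := fintypeLab L d
    inferInstanceAs (Fintype (c.Lab L ⊕ d.Lab L))
  | case _ a b c =>
    have := fintypeLab L a
    have := fintypeLab L b
    have := fintypeLab L c
    inferInstanceAs (Fintype (Option (a.Lab L ⊕ b.Lab L ⊕ c.Lab L)))
  | loop _ a b =>
    have := fintypeLab L a
    have := fintypeLab L b
    inferInstanceAs (Fintype (Option (a.Lab L ⊕ b.Lab L)))
  | call _ _ => inferInstanceAs (Fintype (Option (Option L)))

/-- The label at which a compiled program starts. -/
def Cmd.entry (L : Type) : (c : Cmd K) → c.Lab L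
  | skip => ()
  | push _ _ => ()
  | seq c _ => Sum.inl (c.entry L)
  | case _ _ _ _ => (none : Option _)
  | loop _ _ _ => (none : Option _)
  | call _ _ => (none : Option _)

/-- A Turing machine that reads and writes bits; it serves as the oracle. -/
structure BitMachine where
  tm : FinTM2
  inBit : tm.Γ tm.k₀ ≃ Bool
  outBit : tm.Γ tm.k₁ ≃ Bool

variable (M : BitMachine)

/-- The answers of the oracle given by a machine. -/
def BitMachine.Answers (u v : List Bool) (t : ℕ) : Prop :=
  Nonempty (TM2OutputsInTime M.tm (u.map M.inBit.symm) (some (v.map M.outBit.symm)) t)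

/-- The stack alphabets of a compiled program. -/
abbrev Alph (K : Type) : M.tm.K ⊕ K → Type := Sum.elim M.tm.Γ fun _ => Bool

/-- The internal state of a compiled program: that of the oracle, and the bit read last. -/
abbrev Mem : Type := M.tm.σ × Option Bool

/-- A statement of the oracle machine as part of a larger machine. -/
def liftStmt {Λ' : Type} (lab : M.tm.Λ → Λ') (ex : Λ') :
    TM2.Stmt M.tm.Γ M.tm.Λ M.tm.σ → TM2.Stmt (Alph M K) Λ' (Mem M)
  | .push k f q => .push (Sum.inl k) (fun v => f v.1) (liftStmt lab ex q)
  | .peek k f q => .peek (Sum.inl k) (fun v s => (f v.1 s, v.2)) (liftStmt lab ex q)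
  | .pop k f q => .pop (Sum.inl k) (fun v s => (f v.1 s, v.2)) (liftStmt lab ex q)
  | .load f q => .load (fun v => (f v.1, v.2)) (liftStmt lab ex q)
  | .branch f q q' => .branch (fun v => f v.1) (liftStmt lab ex q) (liftStmt lab ex q')
  | .goto f => .goto fun v => lab (f v.1)
  -- A halting oracle returns control to the calling program.
  | .halt => .goto fun _ => ex

/-- The statement at each label of a compiled program, which continues at the label `ex` of a larger
machine when it ends. -/
def Cmd.code {Λ' : Type} : (c : Cmd K) → (ex : Λ') → (emb : c.Lab M.tm.Λ → Λ') →
    c.Lab M.tm.Λ → TM2.Stmt (Alph M K) Λ' (Mem M)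
  | skip, ex, _, _ => .goto fun _ => ex
  | push k b, ex, _, _ => .push (Sum.inr k) (fun _ => b) (.goto fun _ => ex)
  | seq c d, ex, emb, l =>
    Sum.elim (c.code (emb (Sum.inr (d.entry M.tm.Λ))) fun l => emb (Sum.inl l))
      (d.code ex fun l => emb (Sum.inr l)) l
  | case k a b c, ex, emb, l =>
    Option.elim l
      (.pop (Sum.inr k) (fun v x => (v.1, x)) <| .goto fun v =>
        match v.2 with
        | none => emb (some (Sum.inl (a.entry M.tm.Λ)))
        | some false => emb (some (Sum.inr (Sum.inl (b.entry M.tm.Λ))))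
        | some true => emb (some (Sum.inr (Sum.inr (c.entry M.tm.Λ)))))
      (Sum.elim (a.code ex fun l => emb (some (Sum.inl l)))
        (Sum.elim (b.code ex fun l => emb (some (Sum.inr (Sum.inl l))))
          (c.code ex fun l => emb (some (Sum.inr (Sum.inr l))))))
  | loop k a b, ex, emb, l =>
    Option.elim l
      (.pop (Sum.inr k) (fun v x => (v.1, x)) <| .goto fun v =>
        match v.2 with
        | none => ex
        | some false => emb (some (Sum.inl (a.entry M.tm.Λ)))
        | some true => emb (some (Sum.inr (b.entry M.tm.Λ))))
      (Sum.elim (a.code (emb none) fun l => emb (some (Sum.inl l)))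
        (b.code (emb none) fun l => emb (some (Sum.inr l))))
  | call i o, ex, emb, l =>
    Option.elim l
      (.pop (Sum.inr i) (fun v x => (v.1, x)) <|
        .branch (fun v => v.2.isSome)
          (.push (Sum.inl M.tm.k₀) (fun v => M.inBit.symm (v.2.getD false)) <|
            .goto fun _ => emb none)
          (.goto fun _ => emb (some (some M.tm.main))))
      fun l =>
        Option.elim l
          (.pop (Sum.inl M.tm.k₁) (fun v x => (v.1, x.map M.outBit)) <|
            .branch (fun v => v.2.isSome)
              (.push (Sum.inr o) (fun v => v.2.getD false) <| .goto fun _ => emb (some none))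
              (.goto fun _ => ex))
          fun l => liftStmt M (fun l => emb (some (some l))) (emb (some none)) (M.tm.m l)

/-- `n` steps lead from `c` to `d`. -/
def Steps {C : Type} (f : C → Option C) (n : ℕ) (c d : C) : Prop :=
  (flip bind f)^[n] (some c) = some d

theorem Steps.trans {C : Type} {f : C → Option C} {m n : ℕ} {a b c : C} (h : Steps f m a b)
    (h' : Steps f n b c) : Steps f (m + n) a c := by
  unfold Steps at *
  rw [add_comm, Function.iterate_add_apply, h, h']

theorem Steps.one {C : Type} {f : C → Option C} {a b : C} (h : f a = some b) : Steps f 1 a b := h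

theorem iterate_bind_none {C : Type} (f : C → Option C) (n : ℕ) :
    (flip bind f)^[n] none = none := by
  induction n with
  | zero => rfl
  | succ n ih => rw [Function.iterate_succ_apply]; exact ih

theorem Steps.succ_inv {C : Type} {f : C → Option C} {n : ℕ} {a c : C} (h : Steps f (n + 1) a c) :
    ∃ b, f a = some b ∧ Steps f n b c := by
  unfold Steps at h
  rw [Function.iterate_succ_apply] at h
  cases e : f a with
  | none =>
    have : flip bind f (some a) = none := e
    rw [this, iterate_bind_none] at h
    cases h
  | some b =>
    have : flip bind f (some a) = some b := e
    rw [this] at h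
    exact ⟨b, rfl, h⟩

/-- All stacks of a compiled program, from those of the oracle and those of the program. -/
def joinStk (Q : ∀ k, List (M.tm.Γ k)) (S : K → List Bool) : ∀ k, List (Alph M K k)
  | Sum.inl k => Q k
  | Sum.inr k => S k

open Classical in
instance decEqStk : DecidableEq (M.tm.K ⊕ K) := Classical.decEq _

theorem joinStk_update_inl (Q : ∀ k, List (M.tm.Γ k)) (S : K → List Bool) (k : M.tm.K)
    (l : List (Alph M K (Sum.inl k))) :
    Function.update (joinStk M Q S) (Sum.inl k) l = joinStk M (Function.update Q k l) S := by
  funext j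
  rcases j with j | j
  · by_cases h : j = k
    · subst h
      exact (Function.update_self (Sum.inl j) l (joinStk M Q S)).trans
        (Function.update_self j l Q).symm
    · exact (Function.update_of_ne (fun e => h (Sum.inl.inj e)) l (joinStk M Q S)).trans
        (Function.update_of_ne h l Q).symm
  · exact Function.update_of_ne (Sum.inr_ne_inl : (Sum.inr j : M.tm.K ⊕ K) ≠ Sum.inl k) l
      (joinStk M Q S)

theorem joinStk_update_inr (Q : ∀ k, List (M.tm.Γ k)) {S S' : K → List Bool} {k : K}
    {l : List (Alph M K (Sum.inr k))} (h : S' k = l) (h' : ∀ j, j ≠ k → S' j = S j) :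
    Function.update (joinStk M Q S) (Sum.inr k) l = joinStk M Q S' := by
  funext j
  rcases j with j | j
  · exact Function.update_of_ne (Sum.inl_ne_inr : (Sum.inl j : M.tm.K ⊕ K) ≠ Sum.inr k) l
      (joinStk M Q S)
  · by_cases e : j = k
    · subst e
      exact (Function.update_self (Sum.inr j) l (joinStk M Q S)).trans h.symm
    · exact (Function.update_of_ne (fun e' => e (Sum.inr.inj e')) l (joinStk M Q S)).trans
        (h' j e).symm

/-- A configuration of the oracle as part of a configuration of a larger machine. -/
def liftCfg {Λ' : Type} (lab : M.tm.Λ → Λ') (ex : Λ') (s : Option Bool) (S : K → List Bool)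
    (c : TM2.Cfg M.tm.Γ M.tm.Λ M.tm.σ) : TM2.Cfg (Alph M K) Λ' (Mem M) :=
  ⟨some (c.l.elim ex lab), (c.var, s), joinStk M c.stk S⟩

/-- The halted label `none` is read as `ex` by `liftCfg`, matching the translation of `.halt`. The
simulation is therefore step for step and loses no time. -/
theorem stepAux_liftStmt {Λ' : Type} (lab : M.tm.Λ → Λ') (ex : Λ') (s : Option Bool)
    (S : K → List Bool) (q : TM2.Stmt M.tm.Γ M.tm.Λ M.tm.σ) :
    ∀ v Q, TM2.stepAux (liftStmt M lab ex q) (v, s) (joinStk M Q S) =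
      liftCfg M lab ex s S (TM2.stepAux q v Q) := by
  induction q with
  | push k f q ih =>
    intro v Q
    refine Eq.trans ?_ (ih _ _)
    exact congrArg (TM2.stepAux (liftStmt M lab ex q) _) (joinStk_update_inl M Q S k _)
  | peek k f q ih => intro v Q; exact ih _ _
  | pop k f q ih =>
    intro v Q
    refine Eq.trans ?_ (ih _ _)
    exact congrArg (TM2.stepAux (liftStmt M lab ex q) _) (joinStk_update_inl M Q S k _)
  | load f q ih => intro v Q; exact ih _ _
  | branch f q q' ih ih' =>
    intro v Q
    change cond (f v) _ _ = liftCfg M lab ex s S (cond (f v) _ _)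
    cases f v
    · exact ih' v Q
    · exact ih v Q
  | goto f => intro v Q; rfl
  | halt => intro v Q; rfl

/-- The larger machine simulates the oracle. -/
theorem steps_liftCfg {Λ' : Type} {P : Λ' → TM2.Stmt (Alph M K) Λ' (Mem M)}
    {lab : M.tm.Λ → Λ'} {ex : Λ'} (hP : ∀ l, P (lab l) = liftStmt M lab ex (M.tm.m l))
    (s : Option Bool) (S : K → List Bool) (n : ℕ) :
    ∀ c d : TM2.Cfg M.tm.Γ M.tm.Λ M.tm.σ, Steps (TM2.step M.tm.m) n c d →
      Steps (TM2.step P) n (liftCfg M lab ex s S c) (liftCfg M lab ex s S d) := by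
  induction n with
  | zero =>
    intro c d h
    cases (Option.some.inj h : c = d)
    rfl
  | succ n ih =>
    intro c d h
    obtain ⟨b, hb, h⟩ := h.succ_inv
    obtain ⟨_ | l, v, Q⟩ := c
    · cases hb
    · rw [add_comm]
      refine Steps.trans (Steps.one ?_) (ih _ _ h)
      cases hb
      rw [← stepAux_liftStmt, ← hP]
      rfl

/-- The compiled program started at the label `l`, with the oracle at rest. -/
def restCfg {Λ' : Type} (l : Λ') (s : Option Bool) (S : K → List Bool) :
    TM2.Cfg (Alph M K) Λ' (Mem M) :=
  ⟨some l, (M.tm.initialState, s), joinStk M (fun _ => []) S⟩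

/-- Initial and final configurations in `Function.update` form, to which the lemmas on `joinStk`
apply. -/
theorem initList_eq (T : FinTM2) (s : List (T.Γ T.k₀)) :
    initList T s = ⟨some T.main, T.initialState,
      Function.update (fun _ => []) T.k₀ s⟩ := by
  unfold initList
  congr 1
  funext k
  by_cases h : k = T.k₀
  · subst h; simp
  · simp [h]

theorem haltList_eq (T : FinTM2) (s : List (T.Γ T.k₁)) :
    haltList T s = ⟨none, T.initialState, Function.update (fun _ => []) T.k₁ s⟩ := by
  unfold haltList
  congr 1
  funext k
  by_cases h : k = T.k₁
  · subst h; simp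
  · simp [h]

section Steps

variable {Λ' : Type} {P : Λ' → TM2.Stmt (Alph M K) Λ' (Mem M)}

theorem step_pop_cons {l : Λ'} {k : K} {f : Mem M → Λ'}
    (hl : P l = .pop (Sum.inr k) (fun v x => (v.1, x)) (.goto f)) (s : Option Bool)
    {S S₁ : K → List Bool} {x : Bool} (h : S k = x :: S₁ k) (h₁ : ∀ j, j ≠ k → S₁ j = S j) :
    Steps (TM2.step P) 1 (restCfg M l s S)
      (restCfg M (f (M.tm.initialState, some x)) (some x) S₁) := by
  refine Steps.one ?_
  change some (TM2.stepAux (P l) _ _) = _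
  rw [hl]
  have e : Function.update (joinStk M (fun _ => []) S) (Sum.inr k)
      (joinStk M (fun _ => []) S (Sum.inr k)).tail = joinStk M (fun _ => []) S₁ :=
    joinStk_update_inr M _ (by change S₁ k = (S k).tail; rw [h]; rfl) h₁
  have e' : (joinStk M (fun _ => []) S (Sum.inr k)).head? = some x := by
    change (S k).head? = _
    rw [h]; rfl
  change some (TM2.stepAux (.goto f) (M.tm.initialState, _) (Function.update _ _ _)) = _
  rw [e, e']
  rfl

theorem step_pop_nil {l : Λ'} {k : K} {f : Mem M → Λ'}
    (hl : P l = .pop (Sum.inr k) (fun v x => (v.1, x)) (.goto f)) (s : Option Bool)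
    {S : K → List Bool} (h : S k = []) :
    Steps (TM2.step P) 1 (restCfg M l s S)
      (restCfg M (f (M.tm.initialState, none)) none S) := by
  refine Steps.one ?_
  change some (TM2.stepAux (P l) _ _) = _
  rw [hl]
  have e : Function.update (joinStk M (fun _ => []) S) (Sum.inr k)
      (joinStk M (fun _ => []) S (Sum.inr k)).tail = joinStk M (fun _ => []) S :=
    joinStk_update_inr M _ (by change S k = (S k).tail; rw [h]; rfl) fun _ _ => rfl
  have e' : (joinStk M (fun _ => []) S (Sum.inr k)).head? = none := by
    change (S k).head? = _
    rw [h]; rfl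
  change some (TM2.stepAux (.goto f) (M.tm.initialState, _) (Function.update _ _ _)) = _
  rw [e, e']
  rfl

/-- Moving the query to the input stack of the oracle. -/
theorem steps_query {l l' : Λ'} {i : K}
    (hl : P l = .pop (Sum.inr i) (fun v x => (v.1, x))
        (.branch (fun v => v.2.isSome)
          (.push (Sum.inl M.tm.k₀) (fun v => M.inBit.symm (v.2.getD false)) (.goto fun _ => l))
          (.goto fun _ => l'))) (w : List Bool) :
    ∀ (q : List (M.tm.Γ M.tm.k₀)) (s : Option Bool) (S S' : K → List Bool), S i = w →
      S' i = [] → (∀ j, j ≠ i → S' j = S j) →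
      Steps (TM2.step P) (w.length + 1)
        ⟨some l, (M.tm.initialState, s), joinStk M (Function.update (fun _ => []) M.tm.k₀ q) S⟩
        ⟨some l', (M.tm.initialState, none), joinStk M
          (Function.update (fun _ => []) M.tm.k₀ (w.reverse.map M.inBit.symm ++ q)) S'⟩ := by
  induction w with
  | nil =>
    intro q s S S' h h' h''
    have : S' = S := by
      funext j
      by_cases e : j = i
      · rw [e, h, h']
      · exact h'' j e
    subst this
    refine Steps.one ?_
    change some (TM2.stepAux (P l) _ _) = _
    rw [hl]
    set T := joinStk M (Function.update (fun _ => []) M.tm.k₀ q) S' with hT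
    have e : Function.update T (Sum.inr i) (T (Sum.inr i)).tail = T :=
      joinStk_update_inr M _ (by change S' i = (S' i).tail; rw [h]; rfl) fun _ _ => rfl
    have e' : (T (Sum.inr i)).head? = none := by
      change (S' i).head? = _
      rw [h]; rfl
    change some (TM2.stepAux _ (M.tm.initialState, (T (Sum.inr i)).head?)
      (Function.update _ _ _)) = _
    rw [e, e']
    rfl
  | cons x w ih =>
    intro q s S S' h h' h''
    classical
    set S₁ := Function.update S i w with hS₁
    have hS₁i : S₁ i = w := Function.update_self ..
    have hS₁j : ∀ j, j ≠ i → S₁ j = S j := fun j hj => Function.update_of_ne hj ..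
    have := ih (M.inBit.symm x :: q) (some x) S₁ S' hS₁i h'
      fun j hj => (h'' j hj).trans (hS₁j j hj).symm
    rw [List.length_cons, add_comm (w.length + 1), List.reverse_cons, List.map_append,
      List.append_assoc]
    refine Steps.trans (Steps.one ?_) this
    change some (TM2.stepAux (P l) _ _) = _
    rw [hl]
    set T := joinStk M (Function.update (fun _ => []) M.tm.k₀ q) S with hT
    have e : Function.update T (Sum.inr i) (T (Sum.inr i)).tail =
        joinStk M (Function.update (fun _ => []) M.tm.k₀ q) S₁ :=
      joinStk_update_inr M _ (by change S₁ i = (S i).tail; rw [h, hS₁i]; rfl) hS₁j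
    have e' : (T (Sum.inr i)).head? = some x := by
      change (S i).head? = _
      rw [h]; rfl
    change some (TM2.stepAux _ (M.tm.initialState, (T (Sum.inr i)).head?)
      (Function.update _ _ _)) = _
    rw [e, e']
    refine congrArg some ?_
    change TM2.Cfg.mk _ _ (Function.update _ _ _) = _
    refine congrArg (TM2.Cfg.mk _ _) ?_
    refine (joinStk_update_inl M _ _ _ _).trans ?_
    refine congrArg (fun Q => joinStk M Q S₁) ?_
    refine (Function.update_idem _ _ _).trans ?_
    refine congrArg (Function.update _ _) ?_
    refine congrArg (List.cons _) ?_
    exact Function.update_self (β := fun k => List (M.tm.Γ k)) M.tm.k₀ q fun _ => []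

/-- Moving the answer of the oracle to a stack of the program. -/
theorem steps_answer {l l' : Λ'} {o : K}
    (hl : P l = .pop (Sum.inl M.tm.k₁) (fun v x => (v.1, x.map M.outBit))
        (.branch (fun v => v.2.isSome)
          (.push (Sum.inr o) (fun v => v.2.getD false) (.goto fun _ => l))
          (.goto fun _ => l'))) (w : List Bool) :
    ∀ (s : Option Bool) (S S' : K → List Bool), S' o = w.reverse ++ S o →
      (∀ j, j ≠ o → S' j = S j) →
      Steps (TM2.step P) (w.length + 1)
        ⟨some l, (M.tm.initialState, s), joinStk M
          (Function.update (fun _ => []) M.tm.k₁ (w.map M.outBit.symm)) S⟩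
        (restCfg M l' none S') := by
  have hupd : ∀ (a b : List (M.tm.Γ M.tm.k₁)) (S : K → List Bool),
      Function.update (joinStk M (Function.update (fun _ => []) M.tm.k₁ a) S)
        (Sum.inl M.tm.k₁) b = joinStk M (Function.update (fun _ => []) M.tm.k₁ b) S := by
    intro a b S
    refine (joinStk_update_inl M _ _ _ _).trans ?_
    exact congrArg (fun Q => joinStk M Q S) (Function.update_idem _ _ _)
  have hget : ∀ (a : List (M.tm.Γ M.tm.k₁)) (S : K → List Bool),
      joinStk M (Function.update (fun _ => []) M.tm.k₁ a) S (Sum.inl M.tm.k₁) = a :=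
    fun a _ => Function.update_self (β := fun k => List (M.tm.Γ k)) M.tm.k₁ a fun _ => []
  induction w with
  | nil =>
    intro s S S' h h'
    have : S' = S := by
      funext j
      by_cases e : j = o
      · rw [e, h]; rfl
      · exact h' j e
    subst this
    refine Steps.one ?_
    change some (TM2.stepAux (P l) _ _) = _
    rw [hl]
    change some (TM2.stepAux _ (M.tm.initialState, Option.map M.outBit (List.head?
      (joinStk M (Function.update (fun _ => []) M.tm.k₁ []) S' (Sum.inl M.tm.k₁))))
      (Function.update _ (Sum.inl M.tm.k₁) (List.tail
      (joinStk M (Function.update (fun _ => []) M.tm.k₁ []) S' (Sum.inl M.tm.k₁))))) = _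
    rw [hget]
    refine congrArg some ?_
    change TM2.Cfg.mk _ _ (Function.update _ _ _) = _
    refine congrArg (TM2.Cfg.mk _ _) ?_
    refine (hupd _ _ _).trans ?_
    exact congrArg (fun Q => joinStk M Q S') (Function.update_eq_self_iff.2 rfl)
  | cons x w ih =>
    intro s S S' h h'
    classical
    set S₁ := Function.update S o (x :: S o) with hS₁
    have hS₁i : S₁ o = x :: S o := Function.update_self ..
    have hS₁j : ∀ j, j ≠ o → S₁ j = S j := fun j hj => Function.update_of_ne hj ..
    have := ih (some x) S₁ S' (by rw [h, hS₁i]; simp)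
      fun j hj => (h' j hj).trans (hS₁j j hj).symm
    rw [List.length_cons, add_comm (w.length + 1)]
    refine Steps.trans (Steps.one ?_) this
    change some (TM2.stepAux (P l) _ _) = _
    rw [hl]
    change some (TM2.stepAux _ (M.tm.initialState, Option.map M.outBit (List.head?
      (joinStk M (Function.update (fun _ => []) M.tm.k₁ _) S (Sum.inl M.tm.k₁))))
      (Function.update _ (Sum.inl M.tm.k₁) (List.tail
      (joinStk M (Function.update (fun _ => []) M.tm.k₁ _) S (Sum.inl M.tm.k₁))))) = _
    rw [hget]
    have ex : Option.map M.outBit (List.map M.outBit.symm (x :: w)).head? = some x := by simp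
    rw [ex]
    refine congrArg some ?_
    change TM2.Cfg.mk _ _ (Function.update _ _ _) = _
    refine congrArg (TM2.Cfg.mk _ _) ?_
    refine Eq.trans ?_ (joinStk_update_inr M _ (l := x :: S o) hS₁i hS₁j)
    exact congrArg (fun T : ∀ k, List (Alph M K k) =>
      Function.update T (Sum.inr o) (x :: T (Sum.inr o))) (hupd _ _ _)

end Steps

/-- Compiled programs run as their semantics says. -/
theorem Exec.steps {Λ' : Type} {P : Λ' → TM2.Stmt (Alph M K) Λ' (Mem M)} {c : Cmd K}
    {S S' : K → List Bool} {t : ℕ} (h : Exec M.Answers c S S' t) :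
    ∀ (ex : Λ') (emb : c.Lab M.tm.Λ → Λ'), (∀ l, P (emb l) = c.code M ex emb l) →
      ∀ s, ∃ s' n, n ≤ t ∧
        Steps (TM2.step P) n (restCfg M (emb (c.entry M.tm.Λ)) s S) (restCfg M ex s' S') := by
  induction h with
  | skip =>
    intro ex emb hP s
    refine ⟨s, 1, le_rfl, Steps.one ?_⟩
    change some (TM2.stepAux (P _) _ _) = _
    rw [hP]
    rfl
  | @push S S' k b h h' =>
    intro ex emb hP s
    refine ⟨s, 1, le_rfl, Steps.one ?_⟩
    change some (TM2.stepAux (P _) _ _) = _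
    rw [hP]
    refine congrArg some ?_
    change TM2.Cfg.mk _ _ (Function.update _ _ _) = _
    refine congrArg (TM2.Cfg.mk _ _) ?_
    exact joinStk_update_inr M _ (l := b :: S k) h h'
  | @seq S S₁ S₂ c d _ _ _ _ ih ih' =>
    intro ex emb hP s
    obtain ⟨s₁, n₁, hn₁, h₁⟩ := ih (emb (Sum.inr (d.entry M.tm.Λ)))
      (fun l => emb (Sum.inl l)) (fun l => hP (Sum.inl l)) s
    obtain ⟨s₂, n₂, hn₂, h₂⟩ := ih' ex (fun l => emb (Sum.inr l)) (fun l => hP (Sum.inr l)) s₁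
    exact ⟨s₂, n₁ + n₂, add_le_add hn₁ hn₂, h₁.trans h₂⟩
  | @case_nil S S' k a b c t h _ ih =>
    intro ex emb hP s
    obtain ⟨s', n, hn, h'⟩ := ih ex (fun l => emb (some (Sum.inl l)))
      (fun l => hP (some (Sum.inl l))) none
    exact ⟨s', 1 + n, by omega, (step_pop_nil M (hP none) s h).trans h'⟩
  | @case_cons S S₁ S' k a b c t x h h₁ _ ih =>
    intro ex emb hP s
    cases x
    · obtain ⟨s', n, hn, h'⟩ := ih ex (fun l => emb (some (Sum.inr (Sum.inl l))))
        (fun l => hP (some (Sum.inr (Sum.inl l)))) (some false)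
      exact ⟨s', 1 + n, by omega, (step_pop_cons M (hP none) s h h₁).trans h'⟩
    · obtain ⟨s', n, hn, h'⟩ := ih ex (fun l => emb (some (Sum.inr (Sum.inr l))))
        (fun l => hP (some (Sum.inr (Sum.inr l)))) (some true)
      exact ⟨s', 1 + n, by omega, (step_pop_cons M (hP none) s h h₁).trans h'⟩
  | loop_nil h =>
    intro ex emb hP s
    exact ⟨none, 1, le_rfl, step_pop_nil M (hP none) s h⟩
  | @loop_cons S S₁ S₂ S' k a b _ _ x h h₁ _ _ ih ih' =>
    intro ex emb hP s
    cases x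
    · obtain ⟨s₁, n₁, hn₁, h₁'⟩ := ih (emb none) (fun l => emb (some (Sum.inl l)))
        (fun l => hP (some (Sum.inl l))) (some false)
      obtain ⟨s₂, n₂, hn₂, h₂'⟩ := ih' ex emb hP s₁
      exact ⟨s₂, 1 + n₁ + n₂, by omega, ((step_pop_cons M (hP none) s h h₁).trans h₁').trans h₂'⟩
    · obtain ⟨s₁, n₁, hn₁, h₁'⟩ := ih (emb none) (fun l => emb (some (Sum.inr l)))
        (fun l => hP (some (Sum.inr l))) (some true)
      obtain ⟨s₂, n₂, hn₂, h₂'⟩ := ih' ex emb hP s₁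
      exact ⟨s₂, 1 + n₁ + n₂, by omega, ((step_pop_cons M (hP none) s h h₁).trans h₁').trans h₂'⟩
  | @call S S' i o u v t hio h hi hi' ho h' =>
    intro ex emb hP s
    classical
    obtain ⟨⟨⟨n, hn⟩, hnt⟩⟩ := h
    set S₁ := Function.update S i [] with hS₁
    have hS₁i : S₁ i = [] := Function.update_self ..
    -- Three phases: copy the query in, run the oracle, copy the answer out. `haltList` leaves the
    -- oracle in its initial state with only `k₁` nonempty, so after the third phase it is at rest
    -- and can be called again.
    have hS₁j : ∀ j, j ≠ i → S₁ j = S j := fun j hj => Function.update_of_ne hj ..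
    have a₁ := steps_query M (hP none) u.reverse [] s S S₁ hi hS₁i hS₁j
    have a₂ := steps_liftCfg M (K := K) (lab := fun l => emb (some (some l)))
      (ex := emb (some none)) (fun l => hP (some (some l))) none S₁ n _ _ hn
    have a₃ := steps_answer M (hP (some none)) v none S₁ S' (by rw [ho, hS₁j o hio.symm])
      (fun j hj => by
        by_cases e : j = i
        · rw [e, hi', hS₁i]
        · rw [h' j e hj, hS₁j j e])
    rw [initList_eq, haltList_eq] at a₂
    rw [List.reverse_reverse, List.append_nil] at a₁
    have e : (Function.update (fun _ => []) M.tm.k₀ [] : ∀ k, List (M.tm.Γ k)) = fun _ => [] :=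
      Function.update_eq_self_iff.2 rfl
    rw [e, List.length_reverse] at a₁
    have hnt : n ≤ t := hnt
    exact ⟨none, (u.length + 1) + n + (v.length + 1), by omega, (Steps.trans a₁ a₂).trans a₃⟩
  | weaken _ hst ih =>
    intro ex emb hP s
    obtain ⟨s', n, hn, h⟩ := ih ex emb hP s
    exact ⟨s', n, hn.trans hst, h⟩

/-- The Turing machine that runs a program. -/
def Cmd.machine [Fintype K] (c : Cmd K) (i o : K) : FinTM2 :=
  letI := M.tm.kFin
  letI := M.tm.ΛFin
  letI := M.tm.σFin
  { K := M.tm.K ⊕ K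
    kDecidableEq := decEqStk M
    k₀ := Sum.inr i
    k₁ := Sum.inr o
    Γ := Alph M K
    Λ := Option (c.Lab M.tm.Λ)
    main := some (c.entry M.tm.Λ)
    σ := Mem M
    initialState := (M.tm.initialState, none)
    Γk₀Fin := inferInstanceAs (Fintype Bool)
    -- `haltList` demands the initial internal state, so the exit label resets it before halting.
    -- This is the one step added to the time polynomial.
    m := fun l => l.elim (.load (fun _ => (M.tm.initialState, none)) .halt) (c.code M none some) }

theorem Cmd.computableInPolyTime [Fintype K] (c : Cmd K) {i o : K} {α β : Type}
    {ea : α → List Bool} {eb : β → List Bool} {f : α → β} {S S' : α → K → List Bool}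
    (hS : ∀ a, S a i = ea a) (hS₀ : ∀ a j, j ≠ i → S a j = []) (hS' : ∀ a, S' a o = eb (f a))
    (hS₀' : ∀ a j, j ≠ o → S' a j = []) (p : Polynomial ℕ)
    (h : ∀ a, Exec M.Answers c (S a) (S' a) (p.eval (ea a).length)) :
    Nonempty (TM2ComputableInPolyTime ea eb f) := by
  have stk : ∀ (k : K) (w : List (Alph M K (Sum.inr k))) (T : K → List Bool), T k = w →
      (∀ j, j ≠ k → T j = []) → joinStk M (fun _ => []) T =
        Function.update (fun _ => [] : ∀ k, List (Alph M K k)) (Sum.inr k) w := by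
    intro k w T hk hj
    refine (joinStk_update_inr M (fun _ => []) (S := fun _ => []) (k := k) hk hj).symm.trans ?_
    refine congrArg (fun T : ∀ k, List (Alph M K k) => Function.update T (Sum.inr k) w) ?_
    funext j
    rcases j with j | j <;> rfl
  refine ⟨⟨⟨c.machine M i o, Equiv.refl Bool, Equiv.refl Bool⟩, p + 1, fun a => ?_⟩⟩
  have hex := (h a).steps M (P := (c.machine M i o).m) (none : Option (c.Lab M.tm.Λ)) some
    (fun _ => rfl) none
  have hfin : ∃ n, n ≤ p.eval (ea a).length + 1 ∧ Steps (c.machine M i o).step n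
      (initList (c.machine M i o) (ea a)) (haltList (c.machine M i o) (eb (f a))) := by
    obtain ⟨s, n, hn, hs⟩ := hex
    refine ⟨n + 1, by omega, ?_⟩
    have e₁ : initList (c.machine M i o) (ea a) =
        restCfg M (some (c.entry M.tm.Λ)) none (S a) :=
      (initList_eq (c.machine M i o) (ea a)).trans
        (congrArg (TM2.Cfg.mk _ _) (stk i (ea a) (S a) (hS a) (hS₀ a)).symm)
    have e₂ : (⟨none, (M.tm.initialState, none), joinStk M (fun _ => []) (S' a)⟩ :
        (c.machine M i o).Cfg) = haltList (c.machine M i o) (eb (f a)) :=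
      (congrArg (TM2.Cfg.mk _ _) (stk o (eb (f a)) (S' a) (hS' a) (hS₀' a))).trans
        (haltList_eq (c.machine M i o) (eb (f a))).symm
    have e₃ : (c.machine M i o).step (restCfg M none s (S' a)) =
        some (haltList (c.machine M i o) (eb (f a))) := congrArg some e₂
    exact (congrArg (fun x => Steps (c.machine M i o).step (n + 1) x _) e₁).mpr
      (hs.trans (Steps.one e₃))
  choose n hn hs using hfin
  have ei : List.map (Equiv.refl Bool).invFun (ea a) = ea a := List.map_id _
  have eo : List.map (Equiv.refl Bool).invFun (eb (f a)) = eb (f a) := List.map_id _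
  refine ⟨⟨n, ?_⟩, ?_⟩
  · refine Eq.trans ?_ (Eq.trans hs ?_)
    · exact congrArg (fun l => (flip bind (c.machine M i o).step)^[n]
        (some (initList (c.machine M i o) l))) ei
    · exact congrArg (fun l => some (haltList (c.machine M i o) l)) eo.symm
  · rw [Polynomial.eval_add, Polynomial.eval_one]
    exact hn

end StackProgram

/-! ### Programs with a calling convention and polynomial bounds. -/

namespace StackProgram

open Turing Computability StateTransition

variable {K : Type} {R : List Bool → List Bool → ℕ → Prop}

/-! ### Simple loops -/

/-- Empty a stack. -/
def Cmd.clear (k : K) : Cmd K := .loop k .skip .skip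

/-- Move a stack onto another one, which reverses it. -/
def Cmd.move (a b : K) : Cmd K := .loop a (.push b false) (.push b true)

/-- Move a stack onto two other ones. -/
def Cmd.moveBoth (a b b' : K) : Cmd K :=
  .loop a (.seq (.push b false) (.push b' false)) (.seq (.push b true) (.push b' true))

/-- Push a given word. -/
def Cmd.pushWord (k : K) : List Bool → Cmd K
  | [] => .skip
  | b :: w => .seq (pushWord k w) (.push k b)

theorem Exec.clear {k : K} {S S' : K → List Bool} (h : S' k = []) (h' : ∀ j, j ≠ k → S' j = S j) :
    Exec R (.clear k) S S' (2 * (S k).length + 1) := by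
  generalize hw : S k = w
  induction w generalizing S with
  | nil =>
    have : S' = S := by
      funext j
      by_cases e : j = k
      · rw [e, h, hw]
      · exact h' j e
    subst this
    exact .loop_nil hw
  | cons x w ih =>
    classical
    have e : Function.update S k w k = w := Function.update_self ..
    have e' : ∀ j, j ≠ k → Function.update S k w j = S j := fun j hj => Function.update_of_ne hj ..
    refine (Exec.loop_cons x (by rw [hw, e]) e' (s := 1) ?_
      (ih (fun j hj => (h' j hj).trans (e' j hj).symm) e)).weaken (by simp; omega)
    cases x <;> exact .skip

theorem Exec.move {a b : K} (hab : a ≠ b) {S S' : K → List Bool} (ha : S' a = [])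
    (hb : S' b = (S a).reverse ++ S b) (h' : ∀ j, j ≠ a → j ≠ b → S' j = S j) :
    Exec R (.move a b) S S' (2 * (S a).length + 1) := by
  generalize hw : S a = w
  induction w generalizing S with
  | nil =>
    have : S' = S := by
      funext j
      by_cases e : j = a
      · rw [e, ha, hw]
      by_cases e' : j = b
      · rw [e', hb, hw]; rfl
      · exact h' j e e'
    subst this
    exact .loop_nil hw
  | cons x w ih =>
    classical
    set S₁ := Function.update S a w with hS₁
    set S₂ := Function.update S₁ b (x :: S b) with hS₂
    have e₁ : S₁ a = w := Function.update_self ..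
    have e₁' : ∀ j, j ≠ a → S₁ j = S j := fun j hj => Function.update_of_ne hj ..
    have e₂ : S₂ b = x :: S b := Function.update_self ..
    have e₂' : ∀ j, j ≠ b → S₂ j = S₁ j := fun j hj => Function.update_of_ne hj ..
    refine (Exec.loop_cons x (by rw [hw, e₁]) e₁' (s := 1) (S₂ := S₂) ?_ (ih ?_ ?_ ?_)).weaken
      (by simp; omega)
    · have : Exec R (.push b x) S₁ S₂ 1 := .push (by rw [e₂, e₁' b hab.symm]) e₂'
      cases x <;> exact this
    · rw [hb, hw, e₂, e₂' a hab, e₁]; simp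
    · intro j hj hj'
      rw [h' j hj hj', e₂' j hj', e₁' j hj]
    · rw [e₂' a hab, e₁]

theorem Exec.moveBoth {a b b' : K} (hab : a ≠ b) (hab' : a ≠ b') (hbb : b ≠ b')
    {S S' : K → List Bool} (ha : S' a = []) (hb : S' b = (S a).reverse ++ S b)
    (hb' : S' b' = (S a).reverse ++ S b')
    (h' : ∀ j, j ≠ a → j ≠ b → j ≠ b' → S' j = S j) :
    Exec R (.moveBoth a b b') S S' (3 * (S a).length + 1) := by
  generalize hw : S a = w
  induction w generalizing S with
  | nil =>
    have : S' = S := by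
      funext j
      by_cases e : j = a
      · rw [e, ha, hw]
      by_cases e' : j = b
      · rw [e', hb, hw]; rfl
      by_cases e'' : j = b'
      · rw [e'', hb', hw]; rfl
      · exact h' j e e' e''
    subst this
    exact .loop_nil hw
  | cons x w ih =>
    classical
    set S₁ := Function.update S a w with hS₁
    set S₂ := Function.update S₁ b (x :: S b) with hS₂
    set S₃ := Function.update S₂ b' (x :: S b') with hS₃
    have e₁ : S₁ a = w := Function.update_self ..
    have e₁' : ∀ j, j ≠ a → S₁ j = S j := fun j hj => Function.update_of_ne hj ..
    have e₂ : S₂ b = x :: S b := Function.update_self ..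
    have e₂' : ∀ j, j ≠ b → S₂ j = S₁ j := fun j hj => Function.update_of_ne hj ..
    have e₃ : S₃ b' = x :: S b' := Function.update_self ..
    have e₃' : ∀ j, j ≠ b' → S₃ j = S₂ j := fun j hj => Function.update_of_ne hj ..
    refine (Exec.loop_cons x (by rw [hw, e₁]) e₁' (s := 2) (S₂ := S₃) ?_ (ih ?_ ?_ ?_ ?_)).weaken
      (by simp; omega)
    · have : Exec R (.seq (.push b x) (.push b' x)) S₁ S₃ (1 + 1) :=
        .seq (.push (by rw [e₂, e₁' b hab.symm]) e₂')
          (.push (by rw [e₃, e₂' b' hbb.symm, e₁' b' hab'.symm]) e₃')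
      cases x <;> exact this
    · rw [hb, hw, e₃' b hbb, e₂, e₃' a hab', e₂' a hab, e₁]; simp
    · rw [hb', hw, e₃, e₃' a hab', e₂' a hab, e₁]; simp
    · intro j hj hj' hj''
      rw [h' j hj hj' hj'', e₃' j hj'', e₂' j hj', e₁' j hj]
    · rw [e₃' a hab', e₂' a hab, e₁]

theorem Exec.pushWord {k : K} (w : List Bool) {S S' : K → List Bool} (h : S' k = w ++ S k)
    (h' : ∀ j, j ≠ k → S' j = S j) : Exec R (.pushWord k w) S S' (w.length + 1) := by
  induction w generalizing S' with
  | nil =>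
    have : S' = S := by
      funext j
      by_cases e : j = k
      · rw [e, h]; rfl
      · exact h' j e
    subst this
    exact .skip
  | cons x w ih =>
    classical
    set S₁ := Function.update S k (w ++ S k) with hS₁
    have e₁ : S₁ k = w ++ S k := Function.update_self ..
    have e₁' : ∀ j, j ≠ k → S₁ j = S j := fun j hj => Function.update_of_ne hj ..
    exact .seq (ih e₁ e₁') (.push (by rw [h, e₁]; rfl) fun j hj => (h' j hj).trans (e₁' j hj).symm)

/-! ### Contexts, codes and polynomial bounds -/

/-- Values that are written as one word. -/
class Code (Y : Type) where
  code : Y → List Bool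

/-- Values that are written as finitely many words. -/
class Ctx (X : Type) where
  ι : Type
  [fin : Fintype ι]
  rd : X → ι → List Bool

attribute [reducible, instance] Ctx.fin

open Code Ctx

instance : Code (List Bool) := ⟨id⟩

/-- Numbers are written in unary. -/
instance : Code ℕ := ⟨fun n => List.replicate n true⟩

instance (Y : Type) [Code Y] : Ctx Y where
  ι := Unit
  rd y _ := code y

/-- Contexts nest to the left: each bound variable, such as a loop index, adds one stack to those
already present. -/
instance (X Y : Type) [Ctx X] [Code Y] : Ctx (X × Y) where
  ι := ι X ⊕ Unit
  rd p := Sum.elim (rd p.1) fun _ => code p.2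

/-- The number of bits of a value. -/
def csize {X : Type} [Ctx X] (x : X) : ℕ := ∑ i : ι X, (rd x i).length

theorem csize_prod {X Y : Type} [Ctx X] [Code Y] (x : X) (y : Y) :
    csize (x, y) = csize x + (code y).length := by
  have := Fintype.sum_sum_type (fun i : ι X ⊕ Unit => (rd (x, y) i).length)
  refine this.trans ?_
  simp [csize, rd]

theorem csize_code {Y : Type} [Code Y] (y : Y) : csize y = (code y).length := by
  have : csize y = ∑ _i : Unit, (code y).length := rfl
  rw [this]; simp

theorem polynomial_eval_mono (p : Polynomial ℕ) : Monotone fun n => p.eval n := by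
  intro a b h
  simp only [Polynomial.eval_eq_sum, Polynomial.sum]
  gcongr

/-- Bounded by a polynomial in the number of bits. -/
def PolyBd {X : Type} [Ctx X] (T : X → ℕ) : Prop :=
  ∃ p : Polynomial ℕ, ∀ x, T x ≤ p.eval (csize x)

section PolyBd

variable {X Y : Type} [Ctx X] [Code Y] {S T : X → ℕ}

theorem PolyBd.mono (h : PolyBd T) (hST : ∀ x, S x ≤ T x) : PolyBd S :=
  let ⟨p, hp⟩ := h
  ⟨p, fun x => (hST x).trans (hp x)⟩

theorem PolyBd.const (n : ℕ) : PolyBd fun _ : X => n := ⟨n, fun x => by simp⟩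

theorem PolyBd.csize : PolyBd fun x : X => csize x := ⟨.X, fun x => by simp⟩

theorem PolyBd.rd (i : ι X) : PolyBd fun x : X => (rd x i).length :=
  PolyBd.csize.mono fun x =>
    Finset.single_le_sum (f := fun i => (Ctx.rd x i).length) (fun _ _ => Nat.zero_le _)
      (Finset.mem_univ i)

theorem PolyBd.add (h : PolyBd S) (h' : PolyBd T) : PolyBd fun x => S x + T x :=
  let ⟨p, hp⟩ := h
  let ⟨q, hq⟩ := h'
  ⟨p + q, fun x => by rw [Polynomial.eval_add]; exact add_le_add (hp x) (hq x)⟩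

theorem PolyBd.mul (h : PolyBd S) (h' : PolyBd T) : PolyBd fun x => S x * T x :=
  let ⟨p, hp⟩ := h
  let ⟨q, hq⟩ := h'
  ⟨p * q, fun x => by rw [Polynomial.eval_mul]; exact Nat.mul_le_mul (hp x) (hq x)⟩

theorem PolyBd.eval (p : Polynomial ℕ) (h : PolyBd T) : PolyBd fun x => p.eval (T x) :=
  let ⟨q, hq⟩ := h
  ⟨p.comp q, fun x => by
    rw [Polynomial.eval_comp]
    exact polynomial_eval_mono p (hq x)⟩

end PolyBd

/-! ### Functions computed in polynomial time -/

/-- The stacks of a program that computes a function: those of the context, the output stack, and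
empty work stacks. -/
def sto {X : Type} [Ctx X] {W : Type} (x : X) (o : List Bool) : ι X ⊕ Option W → List Bool
  | .inl i => rd x i
  | .inr none => o
  | .inr (some _) => []

/-- Some program puts the code of `g x` onto the output stack, in polynomial time. -/
def PT (R : List Bool → List Bool → ℕ → Prop) {X Y : Type} [Ctx X] [Code Y] (g : X → Y) : Prop :=
  ∃ (W : Type) (_ : Fintype W) (c : Cmd (ι X ⊕ Option W)) (T : X → ℕ), PolyBd T ∧
    PolyBd (fun x => (code (g x)).length) ∧
    -- The context is restored, the work stacks end empty, and the earlier output `o` is kept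
    -- underneath; this is what makes programs composable.
    ∀ x o, Exec R c (sto x o) (sto x (code (g x) ++ o)) (T x)

/-- Stacks with local variables `V`. -/
def stv {X : Type} [Ctx X] {V W : Type} (x : X) (o : List Bool) (v : V → List Bool) :
    ι X ⊕ Option (V ⊕ W) → List Bool
  | .inl i => rd x i
  | .inr none => o
  | .inr (some (.inl a)) => v a
  | .inr (some (.inr _)) => []

theorem stv_nil {X : Type} [Ctx X] {V W : Type} (x : X) (o : List Bool) :
    (stv x o (fun _ => []) : ι X ⊕ Option (V ⊕ W) → List Bool) = sto x o := by
  funext j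
  rcases j with i | _ | a | w <;> rfl

/-- Place the stacks of a subprogram in those of a program with local variables. -/
def place {I V W W' : Type} (loc : Option V) (j : W → W') :
    I ⊕ Option W → I ⊕ Option (V ⊕ W')
  | .inl i => .inl i
  | .inr none => .inr (loc.map .inl)
  | .inr (some w) => .inr (some (.inr (j w)))

/-- Place the stacks of a subprogram which reads the local variable `a`. -/
def placeExt {I V W W' : Type} (a : V) (j : W → W') :
    (I ⊕ Unit) ⊕ Option W → I ⊕ Option (V ⊕ W')
  | .inl (.inl i) => .inl i
  | .inl (.inr _) => .inr (some (.inl a))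
  | .inr none => .inr none
  | .inr (some w) => .inr (some (.inr (j w)))

theorem place_injective {I V W W' : Type} (loc : Option V) {j : W → W'}
    (hj : Function.Injective j) : Function.Injective (place (I := I) loc j) := by
  rintro (i | _ | w) (i' | _ | w') <;> cases loc <;> simp [place, hj.eq_iff]

theorem placeExt_injective {I V W W' : Type} (a : V) {j : W → W'}
    (hj : Function.Injective j) : Function.Injective (placeExt (I := I) a j) := by
  rintro ((i | _) | _ | w) ((i' | _) | _ | w') <;> simp [placeExt, hj.eq_iff]

section Run

variable {X Y Z : Type} [Ctx X] [Code Y] [Code Z] {V W W' : Type} {j : W → W'}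

/-- Calling a subprogram inside a larger store: `run_out` directs its output to the main output,
`run_loc` to a local variable, and `run_ext` lets it read a local variable as the last component of
its context. -/
theorem run_out (hj : Function.Injective j) {g : X → Y} {c : Cmd (ι X ⊕ Option W)}
    {t : ℕ} {x : X} (h : ∀ o, Exec R c (sto x o) (sto x (code (g x) ++ o)) t) (o : List Bool)
    (v : V → List Bool) :
    Exec R (c.map (place none j)) (stv x o v) (stv x (code (g x) ++ o) v) t := by
  refine (h o).map (place_injective none hj) ?_ ?_ ?_
  · rintro (i | _ | w) <;> rfl
  · rintro (i | _ | w) <;> rfl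
  · rintro (i | _ | a | w)
    · exact .inr rfl
    · exact .inl ⟨.inr none, rfl⟩
    · exact .inr rfl
    · exact .inr rfl

theorem run_loc (hj : Function.Injective j) {g : X → Y} {c : Cmd (ι X ⊕ Option W)}
    {t : ℕ} {x : X} (h : ∀ o, Exec R c (sto x o) (sto x (code (g x) ++ o)) t) (o : List Bool) (a : V)
    {v v' : V → List Bool} (ha : v' a = code (g x) ++ v a) (hb : ∀ b, b ≠ a → v' b = v b) :
    Exec R (c.map (place (some a) j)) (stv x o v) (stv x o v') t := by
  refine (h (v a)).map (place_injective (some a) hj) ?_ ?_ ?_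
  · rintro (i | _ | w) <;> rfl
  · rintro (i | _ | w)
    · rfl
    · exact ha
    · rfl
  · rintro (i | _ | b | w)
    · exact .inr rfl
    · exact .inr rfl
    · by_cases e : b = a
      · exact .inl ⟨.inr none, e ▸ rfl⟩
      · exact .inr (hb b e)
    · exact .inr rfl

theorem run_ext (hj : Function.Injective j) {g : X × Y → Z} {c : Cmd (ι (X × Y) ⊕ Option W)}
    {t : ℕ} {x : X} {y : Y}
    (h : ∀ o, Exec R c (sto (x, y) o) (sto (x, y) (code (g (x, y)) ++ o)) t) (o : List Bool)
    (a : V) {v : V → List Bool} (ha : v a = code y) :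
    Exec R (c.map (placeExt a j)) (stv x o v) (stv x (code (g (x, y)) ++ o) v) t := by
  refine (h o).map (placeExt_injective a hj) ?_ ?_ ?_
  · rintro ((i | _) | _ | w)
    · rfl
    · exact ha
    · rfl
    · rfl
  · rintro ((i | _) | _ | w)
    · rfl
    · exact ha
    · rfl
    · rfl
  · rintro (i | _ | a | w)
    · exact .inr rfl
    · exact .inl ⟨.inr none, rfl⟩
    · exact .inr rfl
    · exact .inr rfl

end Run

end StackProgram

/-! ### Closure of polynomial-time computability under programming constructs. -/

namespace StackProgram

open Turing Computability StateTransition Code Ctx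

variable {R : List Bool → List Bool → ℕ → Prop}

/-! ### Closure properties -/

/-- Case distinction on the first bit of a word. -/
def onHead {Z : Type} (l : List Bool) (a b c : Z) : Z :=
  match l with
  | [] => a
  | false :: _ => b
  | true :: _ => c

section Closure

variable {X Y Z : Type} [Ctx X] [Code Y] [Code Z]

/-- Programs see only codes. This allows passing between a number and its unary word. -/
theorem PT.congr_code {g : X → Y} {g' : X → Z} (h : PT R g) (e : ∀ x, code (g' x) = code (g x)) :
    PT R g' := by
  obtain ⟨W, _, c, T, hT, hg, hc⟩ := h
  exact ⟨W, ‹_›, c, T, hT, by simpa only [e] using hg, by simpa only [e] using hc⟩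

theorem PT.congr {g g' : X → Y} (h : PT R g) (e : ∀ x, g' x = g x) : PT R g' :=
  h.congr_code fun x => by rw [e]

theorem PT.polyBd {g : X → Y} (h : PT R g) : PolyBd fun x => (code (g x)).length :=
  let ⟨_, _, _, _, _, hg, _⟩ := h
  hg

theorem PT.const (y : Y) : PT R fun _ : X => y := by
  refine ⟨Empty, inferInstance, .pushWord (.inr none) (code y), fun _ => (code y).length + 1,
    .const _, .const _, fun x o => .pushWord _ rfl ?_⟩
  rintro (i | _ | w) hj
  · rfl
  · exact absurd rfl hj
  · rfl

theorem PT.append {f g : X → List Bool} (hf : PT R f) (hg : PT R g) :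
    PT R fun x => f x ++ g x := by
  obtain ⟨Wf, _, cf, Tf, hTf, hf, hcf⟩ := hf
  obtain ⟨Wg, _, cg, Tg, hTg, hg, hcg⟩ := hg
  refine ⟨Empty ⊕ (Wf ⊕ Wg), inferInstance,
    -- The output grows at its head, so the second word is produced first.
    .seq (cg.map (place none Sum.inr)) (cf.map (place none Sum.inl)), _, hTg.add hTf,
    (hf.add hg).mono fun x => (List.length_append ..).le, fun x o => ?_⟩
  have h₁ := run_out (V := Empty) (Sum.inr_injective (α := Wf)) (hcg x) o fun _ => []
  have h₂ := run_out (V := Empty) (Sum.inl_injective (β := Wg)) (hcf x) (code (g x) ++ o)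
    fun _ => []
  rw [stv_nil, stv_nil] at h₁ h₂
  have := h₁.seq h₂
  rwa [← List.append_assoc] at this

/-- Reading a word of the context. -/
theorem PT.rd (i : ι X) : PT R fun x : X => Ctx.rd x i := by
  refine ⟨Fin 1 ⊕ Empty, inferInstance,
    -- Reading empties the stack. Two moves, the second onto both the source and the output, restore
    -- the source and cancel the reversal.
    .seq (.move (.inl i) (.inr (some (.inl 0))))
      (.moveBoth (.inr (some (.inl 0))) (.inl i) (.inr none)),
    fun x => (2 * (Ctx.rd x i).length + 1) + (3 * (Ctx.rd x i).length + 1),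
    (((PolyBd.const 2).mul (.rd i)).add (.const 1)).add
      (((PolyBd.const 3).mul (.rd i)).add (.const 1)), .rd i, fun x o => ?_⟩
  classical
  let S : ι X ⊕ Option (Fin 1 ⊕ Empty) → List Bool := fun
    | .inl k => if k = i then [] else Ctx.rd x k
    | .inr none => o
    | .inr (some _) => (Ctx.rd x i).reverse
  refine Exec.seq (S₁ := S) (Exec.move (by simp) (if_pos rfl)
    ((List.append_nil _).symm) ?_) ((Exec.moveBoth (by simp) (by simp) (by simp) rfl ?_ ?_
      ?_).weaken (by simp [S]))
  · rintro (k | _ | v | w) hj hj'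
    · exact if_neg fun e : k = i => hj (e ▸ rfl)
    · rfl
    · exact absurd (by rw [Subsingleton.elim v 0]) hj'
    · exact w.elim
  · simp [S, sto]
  · simp [S, sto, code]
  · rintro (k | _ | v | w) hj hj' hj''
    · exact (if_neg fun e : k = i => hj' (e ▸ rfl)).symm
    · exact absurd rfl hj''
    · exact absurd (by rw [Subsingleton.elim v 0]) hj
    · exact w.elim

theorem PT.id {Y : Type} [Code Y] : PT R fun y : Y => y :=
  (PT.rd (X := Y) ()).congr_code fun _ => rfl

theorem PT.snd : PT R fun p : X × Y => p.2 :=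
  (PT.rd (X := X × Y) (Sum.inr ())).congr_code fun _ => rfl

/-- A function of the smaller context. -/
theorem PT.fst {g : X → Z} (h : PT R g) : PT R fun p : X × Y => g p.1 := by
  obtain ⟨W, _, c, T, ⟨p, hp⟩, ⟨q, hq⟩, hc⟩ := h
  let κ : ι X ⊕ Option W → ι (X × Y) ⊕ Option W := Sum.map Sum.inl fun w => w
  have hle : ∀ x : X × Y, csize x.1 ≤ csize x := fun x => by
    rw [← Prod.mk.eta (p := x), csize_prod]; exact Nat.le_add_right _ _
  refine ⟨W, ‹_›, c.map κ, fun x => T x.1,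
    ⟨p, fun x => (hp x.1).trans (polynomial_eval_mono p (hle x))⟩,
    ⟨q, fun x => (hq x.1).trans (polynomial_eval_mono q (hle x))⟩, fun x o => ?_⟩
  refine (hc x.1 o).map (Sum.map_injective.2 ⟨Sum.inl_injective, Function.injective_id⟩) ?_ ?_ ?_
  · rintro (i | _ | w) <;> rfl
  · rintro (i | _ | w) <;> rfl
  · rintro ((i | i) | _ | w)
    · exact .inr rfl
    · exact .inr rfl
    · exact .inl ⟨.inr none, rfl⟩
    · exact .inr rfl

theorem PT.cases {f : X → List Bool} {a b c : X → Z} (hf : PT R f) (ha : PT R a) (hb : PT R b)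
    (hc : PT R c) :
    PT R fun x => onHead (f x) (a x) (b x) (c x) := by
  obtain ⟨Wf, _, cf, Tf, hTf, hf, hcf⟩ := hf
  obtain ⟨Wa, _, ca, Ta, hTa, ha, hca⟩ := ha
  obtain ⟨Wb, _, cb, Tb, hTb, hb, hcb⟩ := hb
  obtain ⟨Wc, _, cc, Tc, hTc, hc, hcc⟩ := hc
  refine ⟨Unit ⊕ (Wf ⊕ (Wa ⊕ (Wb ⊕ Wc))), inferInstance,
    .seq (.seq (cf.map (place (some ()) Sum.inl)) (.case (.inr (some (.inl ())))
      (ca.map (place none fun w => Sum.inr (Sum.inl w)))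
      (cb.map (place none fun w => Sum.inr (Sum.inr (Sum.inl w))))
      (cc.map (place none fun w => Sum.inr (Sum.inr (Sum.inr w))))))
      -- The branch consumes only the first bit; the rest of the tested word must be removed to
      -- leave the work stacks empty.
      (.clear (.inr (some (.inl ())))), _,
      (hTf.add (((hTa.add hTb).add hTc).add (.const 1))).add
        (((PolyBd.const 2).mul hf).add (.const 1)),
      ((ha.add hb).add hc).mono fun x => ?_, fun x o => ?_⟩
  · dsimp only
    rcases f x with _ | ⟨_ | _, l⟩ <;> dsimp only [onHead] <;> omega
  have h₁ := run_loc (V := Unit) (Sum.inl_injective (β := Wa ⊕ (Wb ⊕ Wc))) (hcf x) o ()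
    (v := fun _ => []) (v' := fun _ => f x) (by simp [code]) (fun b h => absurd rfl h)
  rw [stv_nil] at h₁
  have clr : ∀ (o : List Bool) (l : List Bool), l.length ≤ (f x).length →
      Exec R (.clear (.inr (some (.inl ()))))
      (stv x o (fun _ => l)) (sto x o : ι X ⊕ Option (Unit ⊕ (Wf ⊕ (Wa ⊕ (Wb ⊕ Wc)))) → _)
      (2 * (code (f x)).length + 1) := by
    intro o l hl
    refine (Exec.clear rfl ?_).weaken (by simpa [code, stv] using hl)
    rintro (k | _ | v | w) hj
    · rfl
    · rfl
    · exact absurd rfl hj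
    · rfl
  dsimp only
  obtain e | ⟨y, l, e⟩ : f x = [] ∨ ∃ y l, f x = y :: l := by
    rcases f x with _ | ⟨y, l⟩
    · exact .inl rfl
    · exact .inr ⟨y, l, rfl⟩
  · have eo : onHead (f x) (a x) (b x) (c x) = a x := by rw [e]; rfl
    rw [eo]
    have h₂ := run_out (V := Unit) (W' := Wf ⊕ (Wa ⊕ (Wb ⊕ Wc)))
      (j := fun w => Sum.inr (Sum.inl w)) (fun _ _ h => by simpa using h) (hca x) o fun _ => f x
    refine (h₁.seq ((Exec.case_nil ?_ h₂).weaken ?_)).seq (clr _ _ le_rfl)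
    · exact e
    · omega
  · have hl : l.length ≤ (f x).length := by rw [e]; simp
    have fr : ∀ j : ι X ⊕ Option (Unit ⊕ (Wf ⊕ (Wa ⊕ (Wb ⊕ Wc)))), j ≠ .inr (some (.inl ())) →
        stv x o (fun _ => l) j = stv x o (fun _ => f x) j := by
      rintro (k | _ | v | w) hj
      · rfl
      · rfl
      · exact absurd rfl hj
      · rfl
    cases y with
    | false =>
      have eo : onHead (f x) (a x) (b x) (c x) = b x := by rw [e]; rfl
      rw [eo]
      have h₂ := run_out (V := Unit) (W' := Wf ⊕ (Wa ⊕ (Wb ⊕ Wc)))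
        (j := fun w => Sum.inr (Sum.inr (Sum.inl w))) (fun _ _ h => by simpa using h) (hcb x) o
        fun _ => l
      refine (h₁.seq ((Exec.case_cons (S₁ := stv x o (fun _ => l)) false e fr h₂).weaken
        ?_)).seq (clr _ _ hl)
      omega
    | true =>
      have eo : onHead (f x) (a x) (b x) (c x) = c x := by rw [e]; rfl
      rw [eo]
      have h₂ := run_out (V := Unit) (W' := Wf ⊕ (Wa ⊕ (Wb ⊕ Wc)))
        (j := fun w => Sum.inr (Sum.inr (Sum.inr w))) (fun _ _ h => by simpa using h) (hcc x) o
        fun _ => l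
      refine (h₁.seq ((Exec.case_cons (S₁ := stv x o (fun _ => l)) true e fr h₂).weaken
        ?_)).seq (clr _ _ hl)
      omega

/-- The loop pops a unary counter, and what remains on it after a pop is the index passed to the
body. Indices thus run downwards from `N x - 1`; since output is added at the head, the words end up
in increasing order. -/
theorem PT.flatMap {N : X → ℕ} {f : X × ℕ → List Bool} (hN : PT R N) (hf : PT R f) :
    PT R fun x => (List.range (N x)).flatMap fun i => f (x, i) := by
  obtain ⟨Wf, _, cf, Tf, ⟨p, hp⟩, ⟨q, hq⟩, hcf⟩ := hf
  obtain ⟨Wg, _, cg, Tg, hTg, hg, hcg⟩ := hN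
  have hN : PolyBd N := hg.mono fun x => by simp [code]
  have hle : ∀ (p : Polynomial ℕ) (x : X) (i : ℕ), i ≤ N x →
      p.eval (csize (x, i)) ≤ p.eval (csize x + N x) := by
    intro p x i hi
    refine polynomial_eval_mono p ?_
    rw [csize_prod]
    simpa [code] using hi
  refine ⟨Unit ⊕ (Wf ⊕ Wg), inferInstance,
    .seq (cg.map (place (some ()) Sum.inr)) (.loop (.inr (some (.inl ())))
      (cf.map (placeExt () Sum.inl)) (cf.map (placeExt () Sum.inl))), _,
      hTg.add ((hN.mul ((PolyBd.eval p (PolyBd.csize.add hN)).add (.const 1))).add (.const 1)),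
      (hN.mul (PolyBd.eval q (PolyBd.csize.add hN))).mono fun x => ?_, fun x o => ?_⟩
  · have : ∀ n ≤ N x, ((List.range n).flatMap fun i => f (x, i)).length ≤
        n * q.eval (csize x + N x) := by
      intro n
      induction n with
      | zero => simp
      | succ n ih =>
        intro hn
        rw [List.range_succ, List.flatMap_append, List.length_append, Nat.succ_mul]
        refine add_le_add (ih (by omega)) ?_
        simpa [code] using (hq (x, n)).trans (hle q x n (by omega))
    exact this _ le_rfl
  have h₁ := run_loc (V := Unit) (Sum.inr_injective (α := Wf)) (hcg x) o ()
    (v := fun _ => []) (v' := fun _ => code (N x)) (by simp) (fun b h => absurd rfl h)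
  rw [stv_nil] at h₁
  refine h₁.seq ?_
  have : ∀ n ≤ N x, ∀ o, Exec R (.loop (.inr (some (.inl ())))
      (cf.map (placeExt () Sum.inl)) (cf.map (placeExt () Sum.inl)))
      (stv (V := Unit) (W := Wf ⊕ Wg) x o fun _ => code n)
      (sto x (((List.range n).flatMap fun i => f (x, i)) ++ o))
      (n * (p.eval (csize x + N x) + 1) + 1) := by
    intro n
    induction n with
    | zero =>
      intro _ o
      refine Exec.weaken (s := 1) ?_ (by omega)
      have e : (stv (V := Unit) (W := Wf ⊕ Wg) x o fun _ => code 0) = sto x o := stv_nil x o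
      rw [e]
      exact .loop_nil rfl
    | succ n ih =>
      intro hn o
      have h₂ := (run_ext (V := Unit) (Sum.inl_injective (β := Wg)) (hcf (x, n)) o ()
        (v := fun _ => code n) rfl).weaken ((hp _).trans (hle p x n (by omega)))
      have h₃ := ih (by omega) (f (x, n) ++ o)
      rw [List.range_succ, List.flatMap_append, List.flatMap_singleton, List.append_assoc]
      refine (Exec.loop_cons (S₁ := stv x o fun _ => code n) true rfl ?_ h₂ h₃).weaken ?_
      · rintro (k | _ | v | w) hj
        · rfl
        · rfl
        · exact absurd rfl hj
        · rfl
      · rw [Nat.succ_mul]; omega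
  exact this _ le_rfl o

theorem PT.drop {N : X → ℕ} {f : X → List Bool} (hN : PT R N) (hf : PT R f) :
    PT R fun x => (f x).drop (N x) := by
  obtain ⟨Wf, _, cf, Tf, hTf, hf, hcf⟩ := hf
  obtain ⟨Wg, _, cg, Tg, hTg, hg, hcg⟩ := hN
  have hN : PolyBd N := hg.mono fun x => by simp [code]
  let k₀ : ι X ⊕ Option (Fin 3 ⊕ (Wf ⊕ Wg)) := .inr (some (.inl 0))
  let k₁ : ι X ⊕ Option (Fin 3 ⊕ (Wf ⊕ Wg)) := .inr (some (.inl 1))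
  let k₂ : ι X ⊕ Option (Fin 3 ⊕ (Wf ⊕ Wg)) := .inr (some (.inl 2))
  have h12 : k₁ ≠ k₂ := by simp [k₂, k₁]
  refine ⟨Fin 3 ⊕ (Wf ⊕ Wg), inferInstance,
    .seq (.seq (.seq (.seq (cg.map (place (some 0) Sum.inr)) (cf.map (place (some 1) Sum.inl)))
      -- The `case` with trivial branches pops one bit if there is one, so dropping too much is
      -- harmless. The two moves cancel their reversals.
      (.loop k₀ .skip (.case k₁ .skip .skip .skip))) (.move k₁ k₂)) (.move k₂ (.inr none)), _,
    (((hTg.add hTf).add (((PolyBd.const 3).mul hN).add (.const 1))).add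
      (((PolyBd.const 2).mul hf).add (.const 1))).add (((PolyBd.const 2).mul hf).add (.const 1)),
    hf.mono fun x => by simp [code], fun x o => ?_⟩
  have h₁ := run_loc (V := Fin 3) (Sum.inr_injective (α := Wf)) (hcg x) o 0 (v := fun _ => [])
    (v' := ![code (N x), [], []]) (by simp)
    (fun b h => by fin_cases b <;> first | exact absurd rfl h | rfl)
  have h₂ := run_loc (V := Fin 3) (Sum.inl_injective (β := Wg)) (hcf x) o 1
    (v := ![code (N x), [], []])
    (v' := ![code (N x), f x, []]) (by simp [code])
    (fun b h => by fin_cases b <;> first | exact absurd rfl h | rfl)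
  rw [stv_nil] at h₁
  have fr : ∀ (a : Fin 3) (v v' : Fin 3 → List Bool), (∀ b, b ≠ a → v' b = v b) →
      ∀ j : ι X ⊕ Option (Fin 3 ⊕ (Wf ⊕ Wg)), j ≠ .inr (some (.inl a)) →
        stv x o v' j = stv x o v j := by
    rintro a v v' h (k | _ | b | w) hj
    · rfl
    · rfl
    · exact h b fun e => hj (e ▸ rfl)
    · rfl
  have h₃ : ∀ (n : ℕ) (l : List Bool), Exec R (.loop k₀ .skip (.case k₁ .skip .skip .skip))
      (stv x o ![code n, l, []]) (stv x o ![[], l.drop n, []]) (3 * n + 1) := by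
    intro n
    induction n with
    | zero => intro l; exact .loop_nil rfl
    | succ n ih =>
      intro l
      have a₁ := fr 0 ![code (n + 1), l, []] ![code n, l, []]
        (fun b h => by fin_cases b <;> first | exact absurd rfl h | rfl)
      refine (Exec.loop_cons (S₁ := stv x o ![code n, l, []]) (s := 2) true rfl a₁
        (S₂ := stv x o ![code n, l.tail, []]) ?_ (t := 3 * n + 1) ?_).weaken (by omega)
      · cases l with
        | nil => exact .case_nil (t := 1) rfl .skip
        | cons y l =>
          refine .case_cons (t := 1) y rfl (fr 1 ![code n, y :: l, []] ![code n, l, []]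
            (fun b h => by fin_cases b <;> first | exact absurd rfl h | rfl)) ?_
          cases y <;> exact .skip
      · have := ih l.tail
        rwa [List.drop_tail] at this
  have h₄ : Exec R (.move k₁ k₂) (stv x o ![[], (f x).drop (N x), []])
      (stv x o ![[], [], ((f x).drop (N x)).reverse]) (2 * (code (f x)).length + 1) := by
    refine (Exec.move h12 rfl (by simp [stv, k₁, k₂]) ?_).weaken
      (by simp [stv, k₁, code])
    rintro (k | _ | b | w) hj hj'
    · rfl
    · rfl
    · fin_cases b
      · rfl
      · exact absurd rfl hj
      · exact absurd rfl hj'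
    · rfl
  have h₅ : Exec R (.move k₂ (.inr none)) (stv x o ![[], [], ((f x).drop (N x)).reverse])
      (sto x ((f x).drop (N x) ++ o)) (2 * (code (f x)).length + 1) := by
    refine (Exec.move (by simp [k₂]) rfl (by simp [stv, k₂, sto]) ?_).weaken
      (by simp [stv, k₂, code])
    rintro (k | _ | b | w) hj hj'
    · rfl
    · exact absurd rfl hj'
    · fin_cases b
      · rfl
      · rfl
      · exact absurd rfl hj
    · rfl
  exact (((h₁.seq h₂).seq (h₃ (N x) (f x))).seq h₄).seq h₅

theorem PT.length {f : X → List Bool} (hf : PT R f) : PT R fun x => (f x).length := by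
  obtain ⟨Wf, _, cf, Tf, hTf, hf, hcf⟩ := hf
  refine ⟨Unit ⊕ Wf, inferInstance,
    .seq (cf.map (place (some ()) fun w => w)) (.loop (.inr (some (.inl ())))
      (.push (.inr none) true) (.push (.inr none) true)), _,
      hTf.add (((PolyBd.const 2).mul hf).add (.const 1)),
      hf.mono fun x => by simp [code], fun x o => ?_⟩
  have h₁ := run_loc (V := Unit) Function.injective_id (hcf x) o () (v := fun _ => [])
    (v' := fun _ => f x) (by simp [code]) (fun b h => absurd rfl h)
  rw [stv_nil] at h₁
  have h₂ : ∀ (l o : List Bool), Exec R (.loop (.inr (some (.inl ())))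
      (.push (.inr none) true) (.push (.inr none) true)) (stv (V := Unit) (W := Wf) x o fun _ => l)
      (sto x (code l.length ++ o)) (2 * l.length + 1) := by
    intro l
    induction l with
    | nil =>
      intro o
      have e : (stv (V := Unit) (W := Wf) x o fun _ => []) = sto x o := stv_nil x o
      rw [e]
      exact .loop_nil rfl
    | cons y l ih =>
      intro o
      have e : code (y :: l).length ++ o = code l.length ++ (true :: o) := by
        simp [code, List.replicate_succ']
      rw [e]
      refine (Exec.loop_cons (S₁ := stv (V := Unit) (W := Wf) x o fun _ => l) (s := 1) y rfl ?_
        ?_ (ih (true :: o))).weaken (by simp; omega)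
      · rintro (k | _ | v | w) hj
        · rfl
        · rfl
        · exact absurd rfl hj
        · rfl
      · have : Exec R (.push (.inr none) true) (stv (V := Unit) (W := Wf) x o fun _ => l)
            (stv (V := Unit) (W := Wf) x (true :: o) fun _ => l) 1 := by
          refine .push rfl ?_
          rintro (k | _ | v | w) hj
          · rfl
          · exact absurd rfl hj
          · rfl
          · rfl
        cases y <;> exact this
  exact h₁.seq (h₂ (f x) o)

/-- Consulting the oracle. -/
theorem PT.call {f : X → Y} {g : X → Z} (hf : PT R f) {T : X → ℕ} (hT : PolyBd T)
    -- The relation `R` is arbitrary, so a bound on oracle time says nothing by itself about the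
    -- length of the answer.
    (hg : PolyBd fun x => (code (g x)).length) (h : ∀ x, R (code (f x)) (code (g x)) (T x)) :
    PT R g := by
  obtain ⟨Wf, _, cf, Tf, hTf, hf, hcf⟩ := hf
  let k₀ : ι X ⊕ Option (Fin 3 ⊕ Wf) := .inr (some (.inl 0))
  let k₁ : ι X ⊕ Option (Fin 3 ⊕ Wf) := .inr (some (.inl 1))
  let k₂ : ι X ⊕ Option (Fin 3 ⊕ Wf) := .inr (some (.inl 2))
  have h01 : k₀ ≠ k₁ := by simp [k₀, k₁]
  have h12 : k₁ ≠ k₂ := by simp [k₂, k₁]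
  refine ⟨Fin 3 ⊕ Wf, inferInstance,
    .seq (.seq (.seq (cf.map (place (some 0) fun w => w)) (.move k₀ k₁)) (.call k₁ k₂))
      (.move k₂ (.inr none)), _,
    ((hTf.add (((PolyBd.const 2).mul hf).add (.const 1))).add
      (((hf.add hT).add hg).add (.const 2))).add (((PolyBd.const 2).mul hg).add (.const 1)),
    hg, fun x o => ?_⟩
  have h₁ := run_loc (V := Fin 3) Function.injective_id (hcf x) o 0 (v := fun _ => [])
    (v' := ![code (f x), [], []]) (by simp)
    (fun b h => by fin_cases b <;> first | exact absurd rfl h | rfl)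
  rw [stv_nil] at h₁
  have h₂ : Exec R (.move k₀ k₁) (stv x o ![code (f x), [], []])
      (stv x o ![[], (code (f x)).reverse, []]) (2 * (code (f x)).length + 1) := by
    refine Exec.move h01 rfl (by simp [stv, k₁, k₀]) ?_
    rintro (k | _ | b | w) hj hj'
    · rfl
    · rfl
    · fin_cases b
      · exact absurd rfl hj
      · exact absurd rfl hj'
      · rfl
    · rfl
  have h₃ : Exec R (.call k₁ k₂) (stv x o ![[], (code (f x)).reverse, []])
      (stv x o ![[], [], (code (g x)).reverse])
      ((code (f x)).length + T x + (code (g x)).length + 2) := by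
    refine .call h12 (h x) rfl rfl (by simp [stv, k₂]) ?_
    rintro (k | _ | b | w) hj hj'
    · rfl
    · rfl
    · fin_cases b
      · rfl
      · exact absurd rfl hj
      · exact absurd rfl hj'
    · rfl
  have h₄ : Exec R (.move k₂ (.inr none)) (stv x o ![[], [], (code (g x)).reverse])
      (sto x (code (g x) ++ o)) (2 * (code (g x)).length + 1) := by
    refine (Exec.move (by simp [k₂]) rfl (by simp [stv, k₂, sto]) ?_).weaken
      (by simp [stv, k₂])
    rintro (k | _ | b | w) hj hj'
    · rfl
    · exact absurd rfl hj'
    · fin_cases b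
      · rfl
      · rfl
      · exact absurd rfl hj
    · rfl
  exact ((h₁.seq h₂).seq h₃).seq h₄

end Closure

/-- A function computed with a machine as oracle is computed by a Turing machine. -/
theorem PT.computableInPolyTime (M : BitMachine) {X Y : Type} [Code X] [Code Y] {f : X → Y}
    (h : PT M.Answers f) :
    Nonempty (TM2ComputableInPolyTime (code : X → List Bool) (code : Y → List Bool) f) := by
  obtain ⟨W, _, c, T, hT, -, hc⟩ := h
  obtain ⟨p, hp⟩ := hT.add (((PolyBd.const 2).mul (PolyBd.csize (X := X))).add (.const 1))
  -- The program preserves its input, whereas a halting machine may keep only its output; hence the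
  -- final `clear`.
  refine Cmd.computableInPolyTime M (K := Unit ⊕ Option W) (.seq c (.clear (.inl ())))
    (i := .inl ()) (o := .inr none) (S := fun x => sto x [])
    (S' := fun x => Sum.elim (fun _ => []) fun w => w.elim (code (f x)) fun _ => [])
    (fun _ => rfl) ?_ (fun _ => rfl) ?_ p fun x => ?_
  · rintro x (k | _ | w) hj
    · exact absurd rfl hj
    · rfl
    · rfl
  · rintro x (k | _ | w) hj
    · rfl
    · exact absurd rfl hj
    · rfl
  · have h₁ := hc x []
    rw [List.append_nil] at h₁
    have hx : csize x = (code x).length := csize_code x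
    have hp' := hp x
    rw [hx] at hp'
    refine (h₁.seq (.clear rfl ?_)).weaken hp'
    rintro (k | _ | w) hj
    · exact absurd rfl hj
    · rfl
    · rfl

end StackProgram

/-! ### Unary arithmetic, decidable predicates and logarithms. -/

namespace StackProgram

open Code Ctx

variable {R : List Bool → List Bool → ℕ → Prop}

/-! ### Arithmetic and bounded quantification -/

open Classical in
/-- Some program decides `P` in polynomial time. -/
def PD (R : List Bool → List Bool → ℕ → Prop) {X : Type} [Ctx X] (P : X → Prop) : Prop :=
  -- Falsity is the empty word, so that concatenation over an index range acts as a disjunction.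
  PT R fun x => if P x then [true] else ([] : List Bool)

section Arithmetic

variable {X Y Z : Type} [Ctx X] [Code Y] [Code Z]

theorem code_nat (n : ℕ) : code n = List.replicate n true := rfl

open Classical in
theorem PT.ite {P : X → Prop} {f g : X → Z} (hP : PD R P) (hf : PT R f) (hg : PT R g) :
    PT R fun x => if P x then f x else g x :=
  (PT.cases hP hg hg hf).congr fun x => by
    by_cases h : P x <;> simp [h, onHead]

theorem PD.congr {P Q : X → Prop} (h : PD R P) (e : ∀ x, Q x ↔ P x) : PD R Q :=
  (funext fun x => propext (e x) : Q = P) ▸ h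

theorem PD.and {P Q : X → Prop} (hP : PD R P) (hQ : PD R Q) : PD R fun x => P x ∧ Q x :=
  (PT.ite hP hQ (PT.const [])).congr fun x => by
    by_cases h : P x <;> by_cases h' : Q x <;> simp [h, h']

theorem PD.not {P : X → Prop} (hP : PD R P) : PD R fun x => ¬ P x :=
  (PT.ite hP (PT.const []) (PT.const [true])).congr fun x => by
    by_cases h : P x <;> simp [h]

theorem PD.or {P Q : X → Prop} (hP : PD R P) (hQ : PD R Q) : PD R fun x => P x ∨ Q x :=
  (hP.not.and hQ.not).not.congr fun x => by tauto

theorem PD.imp {P Q : X → Prop} (hP : PD R P) (hQ : PD R Q) : PD R fun x => P x → Q x :=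
  (hP.and hQ.not).not.congr fun x => by tauto

theorem PT.add {f g : X → ℕ} (hf : PT R f) (hg : PT R g) : PT R fun x => f x + g x :=
  (PT.append (hf.congr_code (g' := fun x => code (f x)) fun _ => rfl)
    (hg.congr_code (g' := fun x => code (g x)) fun _ => rfl)).congr_code fun x => by
      simp only [code_nat, List.replicate_add]; rfl

/-- Dropping bits from a unary word is truncated subtraction; all comparisons below derive from it.
-/
theorem PT.sub {f g : X → ℕ} (hf : PT R f) (hg : PT R g) : PT R fun x => f x - g x :=
  (PT.drop hg (hf.congr_code (g' := fun x => code (f x)) fun _ => rfl)).congr_code fun x => by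
    simp only [code_nat, ← List.drop_replicate]; rfl

theorem PT.sum {N : X → ℕ} {f : X × ℕ → ℕ} (hN : PT R N) (hf : PT R f) :
    PT R fun x => ∑ i ∈ Finset.range (N x), f (x, i) :=
  (PT.flatMap hN (hf.congr_code (g' := fun x => code (f x)) fun _ => rfl)).congr_code fun x => by
    have : ∀ n, code (∑ i ∈ Finset.range n, f (x, i)) =
        (List.range n).flatMap fun i => code (f (x, i)) := by
      intro n
      induction n with
      | zero => rfl
      | succ n ih =>
        rw [Finset.sum_range_succ, List.range_succ, List.flatMap_append, ← ih,
          List.flatMap_singleton]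
        simp only [code_nat, List.replicate_add]
    exact this _

theorem PT.mul {f g : X → ℕ} (hf : PT R f) (hg : PT R g) : PT R fun x => f x * g x :=
  (PT.sum hf hg.fst).congr fun x => by simp

theorem PT.pow {f : X → ℕ} (hf : PT R f) (e : ℕ) : PT R fun x => f x ^ e := by
  induction e with
  | zero => exact PT.const 1
  | succ e ih => exact (ih.mul hf).congr fun x => pow_succ ..

theorem PD.eq_zero {f : X → ℕ} (hf : PT R f) : PD R fun x => f x = 0 :=
  (PT.cases (hf.congr_code (g' := fun x => code (f x)) fun _ => rfl) (PT.const [true])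
    (PT.const []) (PT.const [])).congr fun x => by
      rcases h : f x with _ | n
      · simp [code_nat, onHead, h]
      · simp [code_nat, onHead, h, List.replicate_succ]

theorem PD.le {f g : X → ℕ} (hf : PT R f) (hg : PT R g) : PD R fun x => f x ≤ g x :=
  (PD.eq_zero (hf.sub hg)).congr fun x => by omega

theorem PD.lt {f g : X → ℕ} (hf : PT R f) (hg : PT R g) : PD R fun x => f x < g x :=
  (PD.le hg hf).not.congr fun x => by omega

theorem PD.eq {f g : X → ℕ} (hf : PT R f) (hg : PT R g) : PD R fun x => f x = g x :=
  ((PD.le hf hg).and (PD.le hg hf)).congr fun x => by omega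

theorem PD.exists_lt {N : X → ℕ} {P : X × ℕ → Prop} (hN : PT R N) (hP : PD R P) :
    PD R fun x => ∃ i < N x, P (x, i) :=
  (PD.eq_zero (PT.length (PT.flatMap hN hP))).not.congr fun x => by
    simp only [List.length_eq_zero_iff, List.flatMap_eq_nil_iff, List.mem_range]
    push Not
    refine exists_congr fun i => and_congr_right fun _ => ?_
    by_cases h : P (x, i) <;> simp [h]

theorem PD.forall_lt {N : X → ℕ} {P : X × ℕ → Prop} (hN : PT R N) (hP : PD R P) :
    PD R fun x => ∀ i < N x, P (x, i) :=
  (PD.exists_lt hN hP.not).not.congr fun x => by push Not; rfl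

theorem PD.bit {f : X → List Bool} {n : X → ℕ} (hf : PT R f) (hn : PT R n) :
    PD R fun x => (f x)[n x]? = some true :=
  (PT.cases (PT.drop hn hf) (PT.const []) (PT.const []) (PT.const [true])).congr fun x => by
    have e := List.head?_drop (l := f x) (i := n x)
    rcases h : (f x).drop (n x) with _ | ⟨_ | _, l⟩ <;> rw [h] at e <;> simp [onHead, ← e]

/-- The number that a word starts with. -/
theorem PT.of_unary {f : X → List Bool} {n : X → ℕ} (hf : PT R f)
    (h : ∀ x, ∃ l, f x = ElectionIso.unary (n x) ++ l) : PT R n := by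
  classical
  -- The number is recovered by counting the indices `i` for which bits `0` to `i` are all `true`.
  refine (PT.sum hf.length (PT.ite (PD.forall_lt (PT.snd.add (PT.const 1))
    (PD.bit hf.fst.fst PT.snd)) (PT.const 1) (PT.const 0))).congr fun x => ?_
  obtain ⟨l, hl⟩ := h x
  have key : ∀ i, (∀ j < i + 1, (f x)[j]? = some true) ↔ i < n x := by
    intro i
    rw [hl]
    constructor
    · intro hi
      by_contra hni
      have := hi (n x) (by omega)
      simp [ElectionIso.unary] at this
    · intro hi j hj
      have hj' : j < n x := by omega
      simp [ElectionIso.unary, List.getElem?_append, hj']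
  have hn : n x ≤ (f x).length := by rw [hl]; simp [ElectionIso.unary]
  simp only [key, Finset.sum_ite, Finset.sum_const_zero, add_zero, Finset.sum_const,
    smul_eq_mul, mul_one]
  have : (Finset.range (f x).length).filter (· < n x) = Finset.range (n x) := by
    ext i; simp; omega
  rw [this, Finset.card_range]

theorem PT.unary {n : X → ℕ} (hn : PT R n) : PT R fun x => ElectionIso.unary (n x) :=
  (PT.append (hn.congr_code (g' := fun x => code (n x)) fun _ => rfl) (PT.const [false])).congr
    fun _ => rfl

end Arithmetic

/-! ### Powers of two -/

/-- `n` has no odd divisor except `1`. -/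
def IsPowTwo (n : ℕ) : Prop :=
  -- All quantifiers are bounded, so the closure rules for `PD` apply directly.
  n ≠ 0 ∧ ∀ d < n + 1, ∀ c < n + 1, d * c = n → d = 1 ∨ ∃ b < d, b + b = d

theorem isPowTwo_iff {n : ℕ} : IsPowTwo n ↔ ∃ k, n = 2 ^ k := by
  constructor
  · rintro ⟨h0, h⟩
    obtain h' | ⟨p, hp, ⟨c, rfl⟩, hodd⟩ := Nat.eq_two_pow_or_exists_odd_prime_and_dvd n
    · exact h'
    · have hc : 0 < c := Nat.pos_of_ne_zero fun e => h0 (by simp [e])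
      rcases h p (Nat.lt_succ_of_le (Nat.le_mul_of_pos_right p hc)) c
        (Nat.lt_succ_of_le (Nat.le_mul_of_pos_left c hp.pos)) rfl with h1 | ⟨b, -, hb⟩
      · exact absurd h1 hp.one_lt.ne'
      · exact absurd ⟨b, hb.symm⟩ (Nat.not_even_iff_odd.2 hodd)
  · rintro ⟨k, rfl⟩
    refine ⟨by positivity, fun d _ c _ hdc => ?_⟩
    obtain ⟨j, -, rfl⟩ := (Nat.dvd_prime_pow Nat.prime_two).1 ⟨c, hdc.symm⟩
    rcases j with _ | j
    · exact .inl rfl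
    · refine .inr ⟨2 ^ j, ?_, ?_⟩
      · exact Nat.pow_lt_pow_right one_lt_two (Nat.lt_succ_self j)
      · rw [pow_succ]; ring

theorem PD.isPowTwo {X : Type} [Ctx X] {n : X → ℕ} (hn : PT R n) :
    PD R fun x => IsPowTwo (n x) :=
  (PD.eq_zero hn).not.and <|
    PD.forall_lt (P := fun p : X × ℕ => ∀ c < n p.1 + 1, p.2 * c = n p.1 →
      p.2 = 1 ∨ ∃ b < p.2, b + b = p.2) (hn.add (PT.const 1)) <|
    PD.forall_lt (P := fun p : (X × ℕ) × ℕ => p.1.2 * p.2 = n p.1.1 →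
      p.1.2 = 1 ∨ ∃ b < p.1.2, b + b = p.1.2) (hn.fst.add (PT.const 1)) <|
    (PD.eq (PT.snd.fst.mul PT.snd) hn.fst.fst).imp <|
    (PD.eq PT.snd.fst (PT.const 1)).or <|
    PD.exists_lt (P := fun p : ((X × ℕ) × ℕ) × ℕ => p.2 + p.2 = p.1.1.2) PT.snd.fst <|
    PD.eq (PT.snd.add PT.snd) PT.snd.fst.fst

open Classical in
/-- The number of powers of two below `n`. -/
def logTwo (n : ℕ) : ℕ := ∑ i ∈ Finset.range n, if IsPowTwo i then 1 else 0

-- The powers of two below `n` are `1, 2, ..., 2 ^ (z - 1)`, and one plus their sum is `2 ^ z`, the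
-- least power of two that is at least `n`. A power of two of the size of `n` is thus available from
-- sums alone.
open Classical in
theorem one_add_sum_isPowTwo (n : ℕ) :
    1 + (∑ i ∈ Finset.range n, if IsPowTwo i then i else 0) = 2 ^ logTwo n ∧
      n ≤ 2 ^ logTwo n ∧ 2 ^ logTwo n ≤ 2 * n + 1 := by
  -- The strict bound is needed in the induction: when `n` is itself a power of two, `n ≤ 2 ^ z < 2
  -- * n` forces `n = 2 ^ z`.
  suffices 1 + (∑ i ∈ Finset.range n, if IsPowTwo i then i else 0) = 2 ^ logTwo n ∧
      n ≤ 2 ^ logTwo n ∧ (2 ^ logTwo n < 2 * n ∨ logTwo n = 0) by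
    refine ⟨this.1, this.2.1, ?_⟩
    rcases this.2.2 with h | h
    · omega
    · rw [h]; omega
  induction n with
  | zero => simp [logTwo]
  | succ n ih =>
    obtain ⟨h₁, h₂, h₃⟩ := ih
    unfold logTwo at *
    rw [Finset.sum_range_succ, Finset.sum_range_succ]
    generalize (∑ i ∈ Finset.range n, if IsPowTwo i then 1 else 0) = z at *
    by_cases h : IsPowTwo n
    · obtain ⟨k, hk⟩ := isPowTwo_iff.1 h
      have : n = 2 ^ z := by
        rcases h₃ with h₃ | rfl
        · rw [hk] at h₂ h₃ ⊢
          have a := (Nat.pow_le_pow_iff_right (a := 2) (by norm_num)).1 h₂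
          rw [← pow_succ'] at h₃
          have b := (Nat.pow_lt_pow_iff_right (a := 2) (by norm_num)).1 h₃
          congr 1
          omega
        · have : n ≠ 0 := h.1
          simp at h₂ ⊢
          omega
      simp only [h, if_true, pow_succ]
      omega
    · have : n ≠ 2 ^ z := fun e => h (isPowTwo_iff.2 ⟨z, e⟩)
      simp only [h, if_false, add_zero]
      refine ⟨h₁, by omega, ?_⟩
      rcases h₃ with h₃ | h₃
      · left; omega
      · right; exact h₃

theorem PT.logTwo {X : Type} [Ctx X] {n : X → ℕ} (hn : PT R n) :
    PT R fun x => logTwo (n x) := by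
  classical
  exact PT.sum hn (PT.ite (PD.isPowTwo PT.snd) (PT.const 1) (PT.const 0))

theorem PT.two_pow_logTwo {X : Type} [Ctx X] {n : X → ℕ} (hn : PT R n) :
    PT R fun x => 2 ^ StackProgram.logTwo (n x) := by
  classical
  exact ((PT.const 1).add (PT.sum hn (PT.ite (PD.isPowTwo PT.snd) PT.snd (PT.const 0)))).congr
    fun x => (one_add_sum_isPowTwo (n x)).1.symm

end StackProgram

/-! ### Combinatorics of the distances and of the graph elections. -/

namespace ElectionIso

open Finset

/-! ### Spearman distance, swap distance and inversions -/

section Distances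

variable {C : Type*} [Fintype C] {m : ℕ}

theorem spearDist_self (u : PrefOrder C m) : spearDist u u = 0 := by simp [spearDist]

theorem spearDist_triangle (u v w : PrefOrder C m) :
    spearDist u w ≤ spearDist u v + spearDist v w := by
  unfold spearDist
  rw [← sum_add_distrib]
  refine sum_le_sum fun c _ => ?_
  omega

theorem IsAdjacentSwap.spearDist_le {u v : PrefOrder C m} (h : IsAdjacentSwap u v) :
    spearDist u v ≤ 2 := by
  obtain ⟨i, j, hij, rfl⟩ := h
  unfold spearDist
  rw [← Equiv.sum_comp u.symm]
  calc _ ≤ ∑ p : Fin m, ((if p = i then 1 else 0) + (if p = j then 1 else 0)) := by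
        refine sum_le_sum fun p _ => ?_
        simp only [Equiv.trans_apply, Equiv.apply_symm_apply]
        rcases eq_or_ne p i with rfl | hi
        · rw [Equiv.swap_apply_left, if_pos rfl]
          omega
        · rcases eq_or_ne p j with rfl | hj
          · rw [Equiv.swap_apply_right, if_pos rfl]
            omega
          · rw [Equiv.swap_apply_of_ne_of_ne hi hj]
            simp
    _ = 2 := by simp [sum_add_distrib]

theorem SwapReach.spearDist_le {k : ℕ} {u v : PrefOrder C m} (h : SwapReach k u v) :
    spearDist u v ≤ 2 * k := by
  induction k generalizing u with
  | zero =>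
    cases (h : u = v)
    rw [spearDist_self]
  | succ k ih =>
    obtain ⟨w, hw, h⟩ := h
    have := spearDist_triangle u w v
    have := hw.spearDist_le
    have := ih h
    omega

/-- Each swap moves two candidates by one place, so it changes the Spearman distance by at most 2.
-/
theorem spearDist_le_two_mul_swapDist (u v : PrefOrder C m) :
    spearDist u v ≤ 2 * swapDist u v :=
  SwapReach.spearDist_le (Nat.sInf_mem (exists_swapReach u v))

/-- The pairs of candidates which two votes order differently. -/
def inversions (u v : PrefOrder C m) : Finset (C × C) :=
  by classical exact univ.filter fun p => u p.1 < u p.2 ∧ v p.2 < v p.1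

theorem mem_inversions {u v : PrefOrder C m} {p : C × C} :
    p ∈ inversions u v ↔ u p.1 < u p.2 ∧ v p.2 < v p.1 := by
  simp [inversions]

/-- With no adjacent inversion, `v ∘ u⁻¹` is a strictly increasing bijection of `Fin m`, hence the
identity. -/
theorem eq_of_forall_succ {C : Type*} {m : ℕ} {u v : PrefOrder C m}
    (h : ∀ i j : Fin m, (i : ℕ) + 1 = j → v (u.symm i) ≤ v (u.symm j)) : u = v := by
  cases m with
  | zero => exact Equiv.ext fun c => (u c).elim0
  | succ m =>
    have hm : StrictMono fun p => v (u.symm p) := by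
      refine Fin.strictMono_iff_lt_succ.2 fun i => lt_of_le_of_ne (h _ _ (by simp)) fun e => ?_
      have := u.symm.injective (v.injective e)
      exact absurd (congrArg Fin.val this) (by simp)
    have := (StrictMono.range_inj hm strictMono_id).1 (by
      rw [Set.range_id]
      exact (u.symm.trans v).surjective.range_eq)
    refine Equiv.ext fun c => ?_
    have := congrFun this (u c)
    simpa using this.symm

/-- Bubble sort: swapping an adjacent inverted pair removes that inversion and creates none, as no
other pair changes its relative order. -/
theorem exists_swapReach_le (u v : PrefOrder C m) :
    ∃ k ≤ (inversions u v).card, SwapReach k u v := by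
  induction hN : (inversions u v).card using Nat.strong_induction_on generalizing u with
  | _ N ih =>
  subst hN
  by_cases h : ∀ i j : Fin m, (i : ℕ) + 1 = j → v (u.symm i) ≤ v (u.symm j)
  · exact ⟨0, Nat.zero_le _, eq_of_forall_succ h⟩
  · push Not at h
    obtain ⟨i, j, hij, hv⟩ := h
    set w : PrefOrder C m := u.trans (Equiv.swap i j) with hw
    have hsub : inversions w v ⊂ inversions u v := by
      refine Finset.ssubset_iff_subset_ne.2 ⟨fun p hp => ?_, fun e => ?_⟩
      · rw [mem_inversions] at hp ⊢
        refine ⟨?_, hp.2⟩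
        obtain ⟨hp₁, hp₂⟩ := hp
        by_contra hn
        have hne : u p.2 ≠ u p.1 := fun e => by
          rw [u.injective e] at hp₂
          exact lt_irrefl _ hp₂
        have hlt : u p.2 < u p.1 := lt_of_le_of_ne (not_lt.1 hn) hne
        have key : u p.2 = i ∧ u p.1 = j := by
          simp only [hw, Equiv.trans_apply, Equiv.swap_apply_def] at hp₁
          simp only [Fin.lt_def, Fin.ext_iff] at *
          split_ifs at hp₁ <;> omega
        rw [← key.1, ← key.2, Equiv.symm_apply_apply, Equiv.symm_apply_apply] at hv
        exact lt_asymm hv hp₂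
      · have hm : (u.symm i, u.symm j) ∈ inversions u v := by
          rw [mem_inversions]
          refine ⟨?_, hv⟩
          simp only [Equiv.apply_symm_apply, Fin.lt_def]
          omega
        rw [← e, mem_inversions] at hm
        have := hm.1
        simp only [hw, Equiv.trans_apply, Equiv.apply_symm_apply, Equiv.swap_apply_left,
          Equiv.swap_apply_right, Fin.lt_def] at this
        omega
    have hlt := card_lt_card hsub
    obtain ⟨k, hk, hr⟩ := ih _ hlt w rfl
    exact ⟨k + 1, by omega, w, ⟨i, j, hij, rfl⟩, hr⟩

theorem swapDist_le_card_inversions (u v : PrefOrder C m) :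
    swapDist u v ≤ (inversions u v).card :=
  let ⟨_, hk, h⟩ := exists_swapReach_le u v
  (Nat.sInf_le h).trans hk

end Distances

/-! ### The elections of a graph -/

/-- The permutation of the three blocks which vote `i` applies to the candidates with remainder
`r`. -/
def blockPerm (n : ℕ) (A : ℕ → ℕ → Prop) (i r : ℕ) : Equiv.Perm (Fin 3) :=
  -- The exchange with block 2 marks the voter's own vertex, the exchange with block 1 marks
  -- neighbours. The condition `r < n` keeps fillers fixed.
  by classical exact if i = r ∧ r < n then Equiv.swap 0 2 else if A i r then Equiv.swap 0 1 else 1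

theorem blockPerm_blockPerm (n : ℕ) (A : ℕ → ℕ → Prop) (i r : ℕ) (q : Fin 3) :
    blockPerm n A i r (blockPerm n A i r q) = q := by
  unfold blockPerm
  split_ifs <;> simp

/-- The vote of `i`: candidates are numbered by pairs `(q, r)` of a block and a remainder. -/
def graphVote (n t : ℕ) (A : ℕ → ℕ → Prop) (i : ℕ) :
    PrefOrder (Fin (3 * (n + t))) (3 * (n + t)) :=
  (finProdFinEquiv.symm.trans
    ⟨fun p => (blockPerm n A i p.2 p.1, p.2), fun p => (blockPerm n A i p.2 p.1, p.2),
      fun p => by simp [blockPerm_blockPerm], fun p => by simp [blockPerm_blockPerm]⟩).trans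
    finProdFinEquiv

/-- The election of a graph on `{0, …, n - 1}` with adjacency relation `A`. -/
def graphElection (n t : ℕ) (A : ℕ → ℕ → Prop) :
    Election (Fin (3 * (n + t))) (3 * (n + t)) (n + 2) :=
  fun i => graphVote n t A i

theorem graphVote_apply (n t : ℕ) (A : ℕ → ℕ → Prop) (i : ℕ) (q : Fin 3) (r : Fin (n + t)) :
    (graphVote n t A i (finProdFinEquiv (q, r)) : ℕ) =
      r + (n + t) * blockPerm n A i r q := by
  simp only [graphVote, Equiv.trans_apply, Equiv.symm_apply_apply]
  rfl

/-- Every block permutation is an involution. This makes the list of candidates by position, which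
the encoding needs, computable from the position function. -/
theorem graphVote_symm (n t : ℕ) (A : ℕ → ℕ → Prop) (i : ℕ) :
    (graphVote n t A i).symm = graphVote n t A i := by
  refine Equiv.ext fun c => ?_
  rfl

section Iso

variable {n t : ℕ} {A A' : ℕ → ℕ → Prop}

theorem rename_apply {C D : Type*} {m : ℕ} (σ : C ≃ D) (v : PrefOrder C m) (c : C) :
    v.rename σ (σ c) = v c := by
  simp [PrefOrder.rename]

theorem spearDist_rename {C D : Type*} [Fintype C] [Fintype D] {m : ℕ} (σ : C ≃ D)
    (v : PrefOrder C m) (w : PrefOrder D m) :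
    spearDist (v.rename σ) w = ∑ c, (((w (σ c) : ℕ) : ℤ) - ((v c : ℕ) : ℤ)).natAbs := by
  unfold spearDist
  rw [← Equiv.sum_comp σ]
  simp only [rename_apply]

theorem blockPerm_of_le {i r : ℕ} (hA : ∀ i j, A i j → i < n ∧ j < n) (hr : n ≤ r) :
    blockPerm n A i r = 1 := by
  unfold blockPerm
  rw [if_neg (by omega), if_neg fun h => absurd (hA _ _ h).2 (by omega)]

theorem blockPerm_self {i : ℕ} (hi : i < n) : blockPerm n A i i = Equiv.swap 0 2 := by
  unfold blockPerm
  rw [if_pos ⟨rfl, hi⟩]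

theorem blockPerm_of_adj {i r : ℕ} (hir : i ≠ r) (h : A i r) :
    blockPerm n A i r = Equiv.swap 0 1 := by
  unfold blockPerm
  rw [if_neg fun h => hir h.1, if_pos h]

theorem blockPerm_of_not_adj {i r : ℕ} (hir : i ≠ r) (h : ¬ A i r) : blockPerm n A i r = 1 := by
  unfold blockPerm
  rw [if_neg fun h => hir h.1, if_neg h]

/-- Used with `i`, `j` two votes and `c` one candidate, whose two displacements are part of the
total cost. -/
theorem natAbs_lt_of_sum_lt {ι κ : Type*} [Fintype ι] [Fintype κ] {f : ι → κ → ℕ} {t : ℕ}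
    (h : ∑ i, ∑ c, f i c < t) (i j : ι) (hij : i ≠ j) (c : κ) : f i c + f j c < t := by
  classical
  refine lt_of_le_of_lt ?_ h
  have h₁ : ∀ i, f i c ≤ ∑ c, f i c := fun i =>
    single_le_sum (f := fun c => f i c) (fun _ _ => Nat.zero_le _) (mem_univ c)
  have h₂ : ∑ k ∈ ({i, j} : Finset ι), ∑ c, f k c ≤ ∑ i, ∑ c, f i c :=
    sum_le_sum_of_subset (subset_univ _)
  rw [sum_pair hij] at h₂
  have := h₁ i
  have := h₁ j
  omega

/-- A cheap matching of the elections of two graphs comes from an isomorphism. -/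
theorem exists_perm_of_sum_lt (hA' : ∀ i j, A' i j → i < n ∧ j < n) (ν : Equiv.Perm (Fin (n + 2)))
    (σ : Fin (3 * (n + t)) ≃ Fin (3 * (n + t)))
    (h : ∑ i, spearDist ((graphElection n t A i).rename σ) (graphElection n t A' (ν i)) < t) :
    ∃ φ : Equiv.Perm (Fin n), ∀ i j : Fin n, i ≠ j → (A i j ↔ A' (φ i) (φ j)) := by
  simp only [spearDist_rename, graphElection] at h
  -- Follow the block-0 copy of vertex `j`: its image must be the block-0 copy of the vertex whose
  -- voter is matched with voter `j`.
  have key : ∀ j : Fin n, ∃ r' : Fin n, (ν ⟨j, by omega⟩ : ℕ) = r' ∧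
      ∀ i : Fin (n + 2), blockPerm n A' (ν i) r' 0 = blockPerm n A i j 0 := by
    intro j
    have hj := j.2
    have hL : (j : ℕ) < n + t := by omega
    obtain ⟨⟨q', r'⟩, hc⟩ := finProdFinEquiv.surjective (σ (finProdFinEquiv (0, ⟨j, hL⟩)))
    have two : ∀ i i' : Fin (n + 2), i ≠ i' → _ := fun i i' hi =>
      natAbs_lt_of_sum_lt h i i' hi (finProdFinEquiv (0, ⟨j, hL⟩))
    rw [← hc] at two
    simp only [graphVote_apply] at two
    set j₀ : Fin (n + 2) := ⟨j, by omega⟩ with hj₀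
    have pj : blockPerm n A j₀ j 0 = 2 := by
      rw [hj₀, blockPerm_self hj, Equiv.swap_apply_left]
    have pi : ∀ i : Fin (n + 2), i ≠ j₀ → ((blockPerm n A i j 0 : Fin 3) : ℕ) ≤ 1 := by
      intro i hi
      have hi' : (i : ℕ) ≠ j := fun e => hi (Fin.ext e)
      by_cases hij : A i j
      · rw [blockPerm_of_adj hi' hij, Equiv.swap_apply_left]; rfl
      · rw [blockPerm_of_not_adj hi' hij]; exact Nat.zero_le _
    -- The two additional voters guarantee two votes other than that of `j`, even for `n = 1`.
    obtain ⟨i₁, i₂, h₁, h₂, h₁₂⟩ : ∃ i₁ i₂ : Fin (n + 2), i₁ ≠ j₀ ∧ i₂ ≠ j₀ ∧ i₁ ≠ i₂ :=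
      ⟨⟨n, by omega⟩, ⟨n + 1, by omega⟩, by simp [hj₀, Fin.ext_iff]; omega,
        by simp [hj₀, Fin.ext_iff]; omega, by simp⟩
    -- A filler has the same position in all votes, while the candidate is in block 2 for voter `j`
    -- and in block 0 or 1 for `i₁`. The two displacements would add up to at least `n + t`.
    have hr' : (r' : ℕ) < n := by
      by_contra hr'
      have := two j₀ i₁ h₁.symm
      rw [blockPerm_of_le hA' (by omega), blockPerm_of_le hA' (by omega), pj] at this
      have p₁ := pi i₁ h₁
      have e₁ := Nat.mul_le_mul_left (n + t) p₁
      have e₂ : ((2 : Fin 3) : ℕ) = 2 := rfl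
      simp only [Equiv.Perm.coe_one, id_eq, e₂] at this
      generalize (n + t) * (q' : ℕ) = Q at this
      generalize (n + t) * ((blockPerm n A i₁ j 0 : Fin 3) : ℕ) = B at this e₁
      push_cast at this
      omega
    -- Both remainders are below `n`, so a mismatch of blocks would cost more than `(n + t) - n =
    -- t`.
    have blk : ∀ i : Fin (n + 2), blockPerm n A' (ν i) r' q' = blockPerm n A i j 0 := by
      intro i
      obtain ⟨i', hi'⟩ : ∃ i', i ≠ i' := ⟨if i = i₁ then i₂ else i₁, by
        split_ifs with e
        · rw [e]; exact h₁₂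
        · exact e⟩
      have := two i i' hi'
      have := lt_of_le_of_lt (Nat.le_add_right _ _) this
      generalize blockPerm n A' (ν i) r' q' = a at this ⊢
      generalize blockPerm n A i j 0 = b at this ⊢
      by_contra hne
      have hne' : (a : ℕ) ≠ b := fun e => hne (Fin.ext e)
      have hjL := r'.2
      rcases Nat.lt_or_gt_of_ne hne' with hab | hab
      · have := Nat.mul_le_mul_left (n + t) (Nat.succ_le_of_lt hab)
        rw [Nat.mul_succ] at this
        omega
      · have := Nat.mul_le_mul_left (n + t) (Nat.succ_le_of_lt hab)
        rw [Nat.mul_succ] at this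
        omega
    have hν : (ν j₀ : ℕ) = r' ∧ q' = 0 := by
      -- Some vote places the candidate in block 2. A block-0 copy gets there only in its own
      -- vertex's vote, a block-1 copy never. A block-2 copy leaves block 2 in a single vote, yet
      -- the votes of `i₁` and `i₂` both place it in block 0 or 1.
      have hq : q' = 0 ∨ q' = 1 ∨ q' = 2 := by fin_cases q' <;> simp
      have b₀ := blk j₀
      rw [pj] at b₀
      rcases hq with rfl | rfl | rfl
      · refine ⟨?_, rfl⟩
        by_contra hne
        by_cases ha : A' (ν j₀) r'
        · rw [blockPerm_of_adj hne ha] at b₀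
          exact absurd b₀ (by decide)
        · rw [blockPerm_of_not_adj hne ha] at b₀
          exact absurd b₀ (by decide)
      · exfalso
        unfold blockPerm at b₀
        split_ifs at b₀ <;> exact absurd b₀ (by decide)
      · exfalso
        have : ∀ i, i ≠ j₀ → (ν i : ℕ) = r' := by
          intro i hi
          by_contra hne
          have p := pi i hi
          rw [← blk i] at p
          by_cases ha : A' (ν i) r'
          · rw [blockPerm_of_adj hne ha] at p
            exact absurd p (by decide)
          · rw [blockPerm_of_not_adj hne ha] at p
            exact absurd p (by decide)
        exact h₁₂ (ν.injective (Fin.ext ((this i₁ h₁).trans (this i₂ h₂).symm)))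
    obtain ⟨hν, rfl⟩ := hν
    exact ⟨⟨r', hr'⟩, hν, blk⟩
  choose f hf hb using key
  have finj : Function.Injective f := by
    intro a b e
    have := ν.injective (Fin.ext ((hf a).trans ((congrArg Fin.val e).trans (hf b).symm)))
    exact Fin.ext (Fin.mk.inj this)
  refine ⟨Equiv.ofBijective f (Finite.injective_iff_bijective.1 finj), fun i j hij => ?_⟩
  have hij' : (i : ℕ) ≠ j := fun e => hij (Fin.ext e)
  have hfij : (f i : ℕ) ≠ f j := fun e => hij (finj (Fin.ext e))
  have := hb j ⟨i, by omega⟩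
  rw [hf i] at this
  simp only [Equiv.ofBijective_apply]
  by_cases h₁ : A i j <;> by_cases h₂ : A' (f i) (f j)
  · exact ⟨fun _ => h₂, fun _ => h₁⟩
  · rw [blockPerm_of_adj hij' h₁, blockPerm_of_not_adj hfij h₂] at this
    exact absurd this (by decide)
  · rw [blockPerm_of_not_adj hij' h₁, blockPerm_of_adj hfij h₂] at this
    exact absurd this (by decide)
  · exact ⟨fun h => absurd h h₁, fun h => absurd h h₂⟩

/-- A permutation of `Fin n` acting on a larger set of numbers. -/
def extendPerm (φ : Equiv.Perm (Fin n)) {N : ℕ} (h : n ≤ N) : Equiv.Perm (Fin N) :=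
  φ.viaFintypeEmbedding (Fin.castLEEmb h)

theorem extendPerm_of_lt (φ : Equiv.Perm (Fin n)) {N : ℕ} (h : n ≤ N) (x : Fin N)
    (hx : (x : ℕ) < n) : (extendPerm φ h x : ℕ) = φ ⟨x, hx⟩ :=
  congrArg Fin.val (φ.viaFintypeEmbedding_apply_image (Fin.castLEEmb h) ⟨x, hx⟩)

theorem extendPerm_of_le (φ : Equiv.Perm (Fin n)) {N : ℕ} (h : n ≤ N) (x : Fin N)
    (hx : n ≤ (x : ℕ)) : extendPerm φ h x = x := by
  refine φ.viaFintypeEmbedding_apply_notMem_range (Fin.castLEEmb h) ?_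
  rintro ⟨y, hy⟩
  have : (y : ℕ) = x := congrArg Fin.val hy
  omega

/-- The block depends only on whether `i = r`, whether `r < n`, and adjacency; all three are
preserved when `φ` acts on voters and remainders and fixes the rest. -/
theorem blockPerm_extendPerm (hA : ∀ i j, A i j → i < n ∧ j < n)
    (hA' : ∀ i j, A' i j → i < n ∧ j < n) (φ : Equiv.Perm (Fin n))
    (hφ : ∀ i j : Fin n, A i j ↔ A' (φ i) (φ j)) {N N' : ℕ} (hN : n ≤ N) (hN' : n ≤ N')
    (i : Fin N) (r : Fin N') :
    blockPerm n A' (extendPerm φ hN i) (extendPerm φ hN' r) = blockPerm n A i r := by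
  by_cases hr : (r : ℕ) < n
  · rw [extendPerm_of_lt φ hN' r hr]
    by_cases hi : (i : ℕ) < n
    · rw [extendPerm_of_lt φ hN i hi]
      have h₁ : (φ ⟨i, hi⟩ : ℕ) = φ ⟨r, hr⟩ ↔ (i : ℕ) = r := by
        rw [← Fin.ext_iff, φ.injective.eq_iff, Fin.mk.injEq]
      have h₂ := hφ ⟨i, hi⟩ ⟨r, hr⟩
      simp only at h₂
      by_cases e : (i : ℕ) = r
      · simp [blockPerm, e, hr]
      · by_cases ha : A i r
        · rw [blockPerm_of_adj e ha, blockPerm_of_adj (fun h => e (h₁.1 h)) (h₂.1 ha)]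
        · rw [blockPerm_of_not_adj e ha,
            blockPerm_of_not_adj (fun h => e (h₁.1 h)) fun h => ha (h₂.2 h)]
    · rw [extendPerm_of_le φ hN i (by omega)]
      have := (φ ⟨r, hr⟩).2
      rw [blockPerm_of_not_adj (by omega) fun h => absurd (hA' _ _ h).1 hi,
        blockPerm_of_not_adj (by omega) fun h => absurd (hA _ _ h).1 hi]
  · rw [extendPerm_of_le φ hN' r (by omega), blockPerm_of_le hA' (by omega),
      blockPerm_of_le hA (by omega)]

/-- An isomorphism gives a matching with few inversions. -/
theorem exists_card_inversions_le (hA : ∀ i j, A i j → i < n ∧ j < n)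
    (hA' : ∀ i j, A' i j → i < n ∧ j < n) (φ : Equiv.Perm (Fin n))
    (hφ : ∀ i j : Fin n, A i j ↔ A' (φ i) (φ j)) :
    ∃ (ν : Equiv.Perm (Fin (n + 2))) (σ : Fin (3 * (n + t)) ≃ Fin (3 * (n + t))), ∀ i,
      (inversions ((graphElection n t A i).rename σ) (graphElection n t A' (ν i))).card ≤
        (3 * n) * (3 * n) := by
  classical
  have hN : n ≤ n + 2 := by omega
  have hL : n ≤ n + t := by omega
  let σ : Fin (3 * (n + t)) ≃ Fin (3 * (n + t)) :=
    (finProdFinEquiv.symm.trans (Equiv.prodCongr (Equiv.refl (Fin 3)) (extendPerm φ hL))).trans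
      finProdFinEquiv
  have hσ : ∀ q r, σ (finProdFinEquiv (q, r)) = finProdFinEquiv (q, extendPerm φ hL r) := by
    intro q r; simp [σ]
  refine ⟨extendPerm φ hN, σ, fun i => ?_⟩
  set u := (graphElection n t A i).rename σ with hu
  set v := graphElection n t A' (extendPerm φ hN i) with hv
  -- The vertex candidates. Every candidate keeps its block under the matching, fillers keep their
  -- exact position, and vertex candidates stay ahead of the fillers of their block; so both members
  -- of an inverted pair lie in `S`.
  let S : Finset (Fin (3 * (n + t))) :=
    (univ : Finset (Fin 3 × Fin n)).image fun p =>
      σ (finProdFinEquiv (p.1, Fin.castLE hL p.2))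
  have hS : S.card ≤ 3 * n := by
    refine card_image_le.trans ?_
    simp
  refine (card_le_card (t := S ×ˢ S) fun p hp => ?_).trans
    ((card_product S S).le.trans (Nat.mul_le_mul hS hS))
  obtain ⟨x, y⟩ := p
  rw [mem_inversions] at hp
  obtain ⟨x, rfl⟩ := σ.surjective x
  obtain ⟨y, rfl⟩ := σ.surjective y
  obtain ⟨⟨q, r⟩, rfl⟩ := finProdFinEquiv.surjective x
  obtain ⟨⟨q', r'⟩, rfl⟩ := finProdFinEquiv.surjective y
  obtain ⟨h₁, h₂⟩ := hp
  rw [hu, rename_apply, rename_apply] at h₁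
  simp only [hv, hσ, graphElection, Fin.lt_def, graphVote_apply,
    blockPerm_extendPerm hA hA' φ hφ] at h₁ h₂
  have mem : ∀ (q : Fin 3) (r : Fin (n + t)), (r : ℕ) < n → σ (finProdFinEquiv (q, r)) ∈ S :=
    fun q r hr => mem_image.2 ⟨(q, ⟨r, hr⟩), mem_univ _, rfl⟩
  have ext : ∀ r : Fin (n + t), ((r : ℕ) < n ∧ (extendPerm φ hL r : ℕ) < n) ∨
      (n ≤ (r : ℕ) ∧ (extendPerm φ hL r : ℕ) = r) := by
    intro r
    rcases lt_or_ge (r : ℕ) n with hr | hr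
    · exact .inl ⟨hr, by rw [extendPerm_of_lt φ hL r hr]; exact (φ _).2⟩
    · exact .inr ⟨hr, by rw [extendPerm_of_le φ hL r hr]⟩
  have hr := r.2
  have hr' := r'.2
  generalize blockPerm n A i r q = b at h₁ h₂
  generalize blockPerm n A i r' q' = b' at h₁ h₂
  have cmp : (b : ℕ) = b' ∨ (n + t) * (b : ℕ) + (n + t) ≤ (n + t) * (b' : ℕ) ∨
      (n + t) * (b' : ℕ) + (n + t) ≤ (n + t) * (b : ℕ) := by
    rcases lt_trichotomy (b : ℕ) b' with h | h | h
    · exact .inr (.inl (by rw [← Nat.mul_succ]; exact Nat.mul_le_mul_left _ h))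
    · exact .inl h
    · exact .inr (.inr (by rw [← Nat.mul_succ]; exact Nat.mul_le_mul_left _ h))
  have goal : (r : ℕ) < n ∧ (r' : ℕ) < n := by
    have e := ext r
    have e' := ext r'
    rcases cmp with h | h | h
    · rw [h] at h₁ h₂
      omega
    · omega
    · omega
  exact mem_product.2 ⟨mem _ _ goal.1, mem _ _ goal.2⟩

end Iso

theorem exists_sum_eq_isoDist {C D : Type*} [Finite C] {m n : ℕ} (e : C ≃ D)
    (d : PrefOrder D m → PrefOrder D m → ℕ) (E : Election C m n) (E' : Election D m n) :
    ∃ (ν : Equiv.Perm (Fin n)) (σ : C ≃ D),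
      ∑ i, d ((E i).rename σ) (E' (ν i)) = isoDist d E E' := by
  have : Nonempty (Equiv.Perm (Fin n) × (C ≃ D)) := ⟨(1, e)⟩
  obtain ⟨p, hp⟩ := Nat.sInf_mem (Set.range_nonempty
    fun p : Equiv.Perm (Fin n) × (C ≃ D) => ∑ i : Fin n, d ((E i).rename p.2) (E' (p.1 i)))
  exact ⟨p.1, p.2, hp⟩

theorem isoDist_le {C D : Type*} {m n : ℕ} (d : PrefOrder D m → PrefOrder D m → ℕ)
    (E : Election C m n) (E' : Election D m n) (ν : Equiv.Perm (Fin n)) (σ : C ≃ D) :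
    isoDist d E E' ≤ ∑ i, d ((E i).rename σ) (E' (ν i)) :=
  Nat.sInf_le ⟨(ν, σ), rfl⟩

/-- The gap between isomorphic and non-isomorphic graphs. -/
theorem isoDist_graphElection {n t : ℕ} {A A' : ℕ → ℕ → Prop}
    (hA : ∀ i j, A i j → i < n ∧ j < n) (hA' : ∀ i j, A' i j → i < n ∧ j < n)
    (irr : ∀ i, ¬ A i i) (irr' : ∀ i, ¬ A' i i)
    (d : PrefOrder (Fin (3 * (n + t))) (3 * (n + t)) →
      PrefOrder (Fin (3 * (n + t))) (3 * (n + t)) → ℕ)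
    -- These two bounds hold for the Spearman and for the swap distance, so a single argument serves
    -- both.
    (hd : ∀ u v, spearDist u v ≤ 2 * d u v) (hd' : ∀ u v, d u v ≤ 2 * (inversions u v).card) :
    ((∃ φ : Equiv.Perm (Fin n), ∀ i j : Fin n, A i j ↔ A' (φ i) (φ j)) →
      isoDist d (graphElection n t A) (graphElection n t A') ≤ 18 * (n + 2) ^ 3) ∧
    ((¬ ∃ φ : Equiv.Perm (Fin n), ∀ i j : Fin n, A i j ↔ A' (φ i) (φ j)) →
      t ≤ 2 * isoDist d (graphElection n t A) (graphElection n t A')) := by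
  refine ⟨fun ⟨φ, hφ⟩ => ?_, fun h => ?_⟩
  · obtain ⟨ν, σ, h⟩ := exists_card_inversions_le (t := t) hA hA' φ hφ
    refine (isoDist_le d _ _ ν σ).trans ?_
    calc _ ≤ ∑ i : Fin (n + 2), 2 * ((3 * n) * (3 * n)) :=
          sum_le_sum fun i _ => (hd' _ _).trans (Nat.mul_le_mul_left _ (h i))
      _ = (n + 2) * (2 * ((3 * n) * (3 * n))) := by simp
      _ ≤ (n + 2) * (2 * ((3 * (n + 2)) * (3 * (n + 2)))) := by gcongr <;> omega
      _ = 18 * (n + 2) ^ 3 := by ring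
  · by_contra hlt
    obtain ⟨ν, σ, hs⟩ := exists_sum_eq_isoDist (Equiv.refl _) d (graphElection n t A)
      (graphElection n t A')
    refine h ?_
    obtain ⟨φ, hφ⟩ := exists_perm_of_sum_lt hA' ν σ (lt_of_le_of_lt
      (sum_le_sum fun i _ => hd _ _) (by rw [← mul_sum, hs]; omega))
    refine ⟨φ, fun i j => ?_⟩
    by_cases e : i = j
    · subst e
      exact iff_of_false (irr _) (irr' _)
    · exact hφ i j e

end ElectionIso

/-! ### Computing the reduction and deciding isomorphism with it. -/

namespace ElectionIso

open Turing Computability StackProgram StackProgram.Code StackProgram.Ctx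

/-! ### Lists of ranges -/

theorem flatMap_finRange {β : Type*} {n : ℕ} (f : ℕ → List β) :
    ((List.finRange n).flatMap fun i : Fin n => f i) = (List.range n).flatMap f := by
  rw [← List.map_coe_finRange_eq_range, List.flatMap_map]

theorem map_finRange {β : Type*} {n : ℕ} (f : ℕ → β) :
    ((List.finRange n).map fun i : Fin n => f i) = (List.range n).map f := by
  rw [← List.map_coe_finRange_eq_range, List.map_map]
  rfl

theorem flatMap_range_mul {β : Type*} (a b : ℕ) (f : ℕ → List β) :
    (List.range (a * b)).flatMap f =
      (List.range a).flatMap fun q => (List.range b).flatMap fun r => f (b * q + r) := by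
  induction a with
  | zero => simp
  | succ a ih =>
    rw [Nat.succ_mul, List.range_add, List.flatMap_append, ih, List.range_succ,
      List.flatMap_append, List.flatMap_singleton, List.flatMap_map, Nat.mul_comm a b]

theorem length_rows {β : Type*} (n k : ℕ) (f : ℕ → ℕ → β) :
    ((List.range n).flatMap fun i => (List.range k).map (f i)).length = n * k := by
  simp [List.length_flatMap]

theorem getElem?_rows {β : Type*} (n k : ℕ) (f : ℕ → ℕ → β) (l : List β) {i r : ℕ} (hi : i < n)
    (hr : r < k) :
    (((List.range n).flatMap fun i => (List.range k).map (f i)) ++ l)[i * k + r]? =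
      some (f i r) := by
  induction n generalizing l with
  | zero => omega
  | succ n ih =>
    rw [List.range_succ, List.flatMap_append, List.flatMap_singleton, List.append_assoc]
    rcases Nat.lt_succ_iff_lt_or_eq.1 hi with h | rfl
    · exact ih _ h
    · rw [List.getElem?_append_right (by rw [length_rows]; omega), length_rows,
        Nat.add_sub_cancel_left, List.getElem?_append_left (by simpa using hr)]
      simp [hr]

/-! ### Reading graphs -/

/-- The adjacency relation of a graph on `Fin n`, as a relation on all numbers. -/
def adjNat {n : ℕ} (G : SimpleGraph (Fin n)) (i j : ℕ) : Prop :=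
  ∃ (hi : i < n) (hj : j < n), G.Adj ⟨i, hi⟩ ⟨j, hj⟩

theorem adjNat_coe {n : ℕ} (G : SimpleGraph (Fin n)) (i j : Fin n) :
    adjNat G i j ↔ G.Adj i j :=
  ⟨fun ⟨_, _, h⟩ => h, fun h => ⟨i.2, j.2, h⟩⟩

open Classical in
theorem encodeGraph_eq {n : ℕ} (G : SimpleGraph (Fin n)) :
    encodeGraph G = unary n ++
      (List.range n).flatMap fun i => (List.range n).map fun j => decide (adjNat G i j) := by
  rw [encodeGraph, ← flatMap_finRange]
  refine congrArg _ (List.flatMap_congr fun i _ => ?_)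
  rw [← map_finRange]
  refine List.map_congr_left fun j _ => ?_
  simp only [adjNat_coe]

theorem length_encodeGraph {n : ℕ} (G : SimpleGraph (Fin n)) :
    (encodeGraph G).length = n + 1 + n * n := by
  rw [encodeGraph_eq, List.length_append, length_rows]
  simp [unary]

open Classical in
theorem getElem?_encodeGraph {n : ℕ} (G : SimpleGraph (Fin n)) (l : List Bool) {i r : ℕ}
    (hi : i < n) (hr : r < n) :
    (encodeGraph G ++ l)[n + 1 + (i * n + r)]? = some (decide (adjNat G i r)) := by
  have hu : (unary n).length = n + 1 := by simp [unary]
  rw [encodeGraph_eq, List.append_assoc, List.getElem?_append_right (by rw [hu]; omega), hu,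
    Nat.add_sub_cancel_left, getElem?_rows _ _ _ _ hi hr]

variable {R : List Bool → List Bool → ℕ → Prop}

instance : Code GIInstance := ⟨GIInstance.encode⟩

instance : Code IDInstance := ⟨IDInstance.encode⟩

instance : Code Bool := ⟨encodeBool⟩

/-- Adjacency is a single bit of the encoding, after the unary header of length `n + 1` and `i` full
rows. -/
theorem pd_adjNat {X : Type} [Ctx X] {n i r : X → ℕ} {G : ∀ x, SimpleGraph (Fin (n x))}
    {w : X → List Bool} (hw : PT R w) (hn : PT R n) (hi : PT R i) (hr : PT R r)
    (h : ∀ x, ∃ l, w x = encodeGraph (G x) ++ l) : PD R fun x => adjNat (G x) (i x) (r x) := by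
  classical
  refine ((PD.lt hi hn).and ((PD.lt hr hn).and
    (PD.bit hw ((hn.add (PT.const 1)).add ((hi.mul hn).add hr))))).congr fun x => ?_
  obtain ⟨l, hl⟩ := h x
  constructor
  · intro ha
    obtain ⟨h₁, h₂, -⟩ := id ha
    refine ⟨h₁, h₂, ?_⟩
    rw [hl, getElem?_encodeGraph _ _ h₁ h₂, decide_eq_true ha]
  · rintro ⟨h₁, h₂, h₃⟩
    rw [hl, getElem?_encodeGraph _ _ h₁ h₂] at h₃
    simpa using h₃

theorem pt_encode : PT R fun I : GIInstance => I.encode := PT.id.congr_code fun _ => rfl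

theorem pt_n : PT R fun I : GIInstance => I.n :=
  PT.of_unary pt_encode fun I => ⟨_, by
    rw [GIInstance.encode, encodeGraph, List.append_assoc]⟩

theorem drop_encode (I : GIInstance) :
    I.encode.drop (I.n + 1 + I.n * I.n) = encodeGraph I.G' := by
  rw [GIInstance.encode, List.drop_left' (length_encodeGraph I.G)]

theorem pt_encode' : PT R fun I : GIInstance => encodeGraph I.G' :=
  (PT.drop ((pt_n.add (PT.const 1)).add (pt_n.mul pt_n)) pt_encode).congr fun I =>
    (drop_encode I).symm

theorem pt_n' : PT R fun I : GIInstance => I.n' :=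
  PT.of_unary pt_encode' fun _ => ⟨_, rfl⟩

/-! ### Writing elections -/

open Classical in
/-- `blockPerm` on numbers. -/
def blockNat (n : ℕ) (A : ℕ → ℕ → Prop) (i r q : ℕ) : ℕ :=
  if i = r ∧ r < n then if q = 0 then 2 else if q = 2 then 0 else q
  else if A i r then if q = 0 then 1 else if q = 1 then 0 else q else q

theorem blockPerm_eq_blockNat (n : ℕ) (A : ℕ → ℕ → Prop) (i r : ℕ) (q : Fin 3) :
    (blockPerm n A i r q : ℕ) = blockNat n A i r q := by
  unfold blockPerm blockNat
  split_ifs with h₁ h₂ <;> revert q <;> decide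

/-- By `graphVote_symm` the candidate at position `j` is the value of the vote at `j`. Splitting `j`
into block and remainder gives nested loops to which `PT.flatMap` applies. -/
theorem encodeElection_graphElection (n t : ℕ) (A : ℕ → ℕ → Prop) :
    encodeElection (graphElection n t A) =
      (List.range (n + 2)).flatMap fun i => (List.range 3).flatMap fun q =>
        (List.range (n + t)).flatMap fun r => unary (r + (n + t) * blockNat n A i r q) := by
  rw [encodeElection, ← flatMap_finRange]
  refine List.flatMap_congr fun i _ => ?_
  let f : ℕ → List Bool := fun j =>
    unary (j % (n + t) + (n + t) * blockNat n A i (j % (n + t)) (j / (n + t)))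
  have h₁ : ∀ j : Fin (3 * (n + t)), unary ((graphElection n t A i).symm j) = f j := by
    intro j
    obtain ⟨⟨q, r⟩, rfl⟩ := finProdFinEquiv.surjective j
    have hL : 0 < n + t := lt_of_le_of_lt (Nat.zero_le _) r.2
    have e : ((finProdFinEquiv (q, r) : Fin (3 * (n + t))) : ℕ) = r + (n + t) * q := rfl
    simp only [graphElection, graphVote_symm, graphVote_apply, f, e, Nat.add_mul_mod_self_left,
      Nat.mod_eq_of_lt r.2, Nat.add_mul_div_left _ _ hL, Nat.div_eq_of_lt r.2, zero_add,
      blockPerm_eq_blockNat]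
  rw [List.flatMap_congr fun j _ => h₁ j, flatMap_finRange, flatMap_range_mul]
  refine List.flatMap_congr fun q _ => List.flatMap_congr fun r hr => ?_
  have hr : r < n + t := List.mem_range.1 hr
  have hL : 0 < n + t := by omega
  simp only [f, Nat.mul_add_mod, Nat.mod_eq_of_lt hr, Nat.mul_add_div hL, Nat.div_eq_of_lt hr,
    add_zero]

theorem pt_blockNat {X : Type} [Ctx X] {n i r q : X → ℕ} {A : X → ℕ → ℕ → Prop}
    (hn : PT R n) (hi : PT R i) (hr : PT R r) (hq : PT R q)
    (hA : PD R fun x => A x (i x) (r x)) :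
    PT R fun x => blockNat (n x) (A x) (i x) (r x) (q x) :=
  (PT.ite ((PD.eq hi hr).and (PD.lt hr hn))
    (PT.ite (PD.eq hq (PT.const 0)) (PT.const 2)
      (PT.ite (PD.eq hq (PT.const 2)) (PT.const 0) hq))
    (PT.ite hA (PT.ite (PD.eq hq (PT.const 0)) (PT.const 1)
      (PT.ite (PD.eq hq (PT.const 1)) (PT.const 0) hq)) hq)).congr fun x => by
        unfold blockNat
        split_ifs <;> rfl

theorem pt_encodeElection {X : Type} [Ctx X] {n t : X → ℕ} {A : X → ℕ → ℕ → Prop}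
    (hn : PT R n) (ht : PT R t)
    (hA : PD R fun x : ((X × ℕ) × ℕ) × ℕ => A x.1.1.1 x.1.1.2 x.2) :
    PT R fun x => encodeElection (graphElection (n x) (t x) (A x)) := by
  have hL : PT R fun x => n x + t x := hn.add ht
  have h₃ : PT R fun p : ((X × ℕ) × ℕ) × ℕ =>
      unary (p.2 + (n p.1.1.1 + t p.1.1.1) *
        blockNat (n p.1.1.1) (A p.1.1.1) p.1.1.2 p.2 p.1.2) :=
    PT.unary (PT.snd.add (hL.fst.fst.fst.mul
      (pt_blockNat (A := fun p : ((X × ℕ) × ℕ) × ℕ => A p.1.1.1) hn.fst.fst.fst PT.snd.fst.fst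
        PT.snd PT.snd.fst hA)))
  have h₂ := PT.flatMap hL.fst.fst h₃
  have h₁ := PT.flatMap (PT.const 3) h₂
  exact (PT.flatMap (hn.add (PT.const 2)) h₁).congr fun x => encodeElection_graphElection ..

/-! ### The reduction -/

/-- The number of candidates that separate the blocks. -/
def gapSize (e n : ℕ) : ℕ := (2 ^ logTwo (n + 2)) ^ e

theorem gapSize_pos (e n : ℕ) : 0 < gapSize e n := by unfold gapSize; positivity

/-- The pair of elections made from two graphs. -/
def reduction (e : ℕ) (I : GIInstance) : IDInstance where
  m := 3 * (I.n + gapSize e I.n)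
  n := I.n + 2
  m_pos := by have := gapSize_pos e I.n; omega
  E := graphElection I.n (gapSize e I.n) (adjNat I.G)
  -- The size of the first graph is used for both elections; graphs of different order are rejected
  -- by a separate test.
  E' := graphElection I.n (gapSize e I.n) (adjNat I.G')

theorem pt_gapSize (e : ℕ) : PT R fun I : GIInstance => gapSize e I.n :=
  PT.pow (PT.two_pow_logTwo (pt_n.add (PT.const 2))) e

theorem pt_reduction (e : ℕ) : PT R (reduction e) := by
  have hE : PT R fun I : GIInstance =>
      encodeElection (graphElection I.n (gapSize e I.n) (adjNat I.G)) := by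
    refine pt_encodeElection (n := fun I : GIInstance => I.n) (t := fun I => gapSize e I.n)
      (A := fun I => adjNat I.G) pt_n (pt_gapSize e) ?_
    exact pd_adjNat (n := fun p : ((GIInstance × ℕ) × ℕ) × ℕ => p.1.1.1.n)
      (i := fun p => p.1.1.2) (r := fun p => p.2) (G := fun p => p.1.1.1.G)
      pt_encode.fst.fst.fst pt_n.fst.fst.fst PT.snd.fst.fst PT.snd fun p => ⟨_, rfl⟩
  have hE' : PT R fun I : GIInstance =>
      encodeElection (graphElection I.n (gapSize e I.n) (adjNat I.G')) := by
    refine pt_encodeElection (n := fun I : GIInstance => I.n) (t := fun I => gapSize e I.n)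
      (A := fun I => adjNat I.G') pt_n (pt_gapSize e) ?_
    exact pd_adjNat (n := fun p : ((GIInstance × ℕ) × ℕ) × ℕ => p.1.1.1.n')
      (i := fun p => p.1.1.2) (r := fun p => p.2) (G := fun p => p.1.1.1.G')
      pt_encode'.fst.fst.fst pt_n'.fst.fst.fst PT.snd.fst.fst PT.snd
      fun p => ⟨[], (List.append_nil _).symm⟩
  exact ((((PT.const 3).mul (pt_n.add (pt_gapSize e))).unary.append
    (pt_n.add (PT.const 2)).unary).append hE |>.append hE').congr_code fun I => by
      change IDInstance.encode _ = id _
      rw [IDInstance.encode, id]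
      rfl

/-! ### The gap -/

theorem length_encodeNat (a : ℕ) : (encodeNat a).length = Nat.size a := by
  have pos : ∀ p : PosNum, (encodePosNum p).length = p.natSize := by
    intro p
    induction p with
    | one => rfl
    | bit0 p ih => simp [encodePosNum, PosNum.natSize, ih]
    | bit1 p ih => simp [encodePosNum, PosNum.natSize, ih]
  have num : ∀ p : Num, (encodeNum p).length = p.natSize := by
    rintro (_ | p)
    · rfl
    · exact pos p
  rw [encodeNat, num, Num.natSize_to_nat, Num.to_of_nat]

theorem length_encodeNat_le_iff (a s : ℕ) : (encodeNat a).length ≤ s ↔ a < 2 ^ s := by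
  rw [length_encodeNat, Nat.size_le]

/-- The exponent of half the gap size. -/
def threshold (e n : ℕ) : ℕ := logTwo (n + 2) * e - 1

theorem le_two_pow_logTwo (n : ℕ) : n + 2 ≤ 2 ^ logTwo (n + 2) :=
  (one_add_sum_isPowTwo (n + 2)).2.1

theorem two_mul_two_pow_threshold {e : ℕ} (he : 0 < e) (n : ℕ) :
    2 * 2 ^ threshold e n = gapSize e n := by
  have h := le_two_pow_logTwo n
  have hz : logTwo (n + 2) ≠ 0 := fun h0 => by rw [h0] at h; omega
  have : 0 < logTwo (n + 2) * e := Nat.mul_pos (Nat.pos_of_ne_zero hz) he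
  rw [threshold, gapSize, ← pow_mul, ← pow_succ', Nat.sub_add_cancel this]

/-- Measure everything in powers of `q = 2 ^ logTwo (n + 2)`: the number of candidates is at most `q
^ (e + 3)`, the isomorphic cost at most `q ^ 8`, and half the gap at least `q ^ (e - 1)`. It remains
to have `(e + 3) * β + 8 < e - 1`. -/
theorem exists_exponent {α : ℝ} (hα : α < 1) : ∃ e : ℕ, 0 < e ∧ ∀ n : ℕ,
    ((3 * (n + gapSize e n) : ℕ) : ℝ) ^ α * (18 * (n + 2) ^ 3 : ℕ) < 2 ^ threshold e n := by
  obtain ⟨β, hβ0, hαβ, hβ⟩ : ∃ β : ℝ, 0 ≤ β ∧ α ≤ β ∧ β < 1 :=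
    -- A nonnegative exponent is needed for monotonicity in the base.
    ⟨max α 0, le_max_right _ _, le_max_left _ _, max_lt hα one_pos⟩
  -- The requirement is `e * (1 - β) > 9 + 3 * β`, and the right side is below 12.
  obtain ⟨e, he⟩ := exists_nat_gt (12 / (1 - β))
  have hβ' : 0 < 1 - β := by linarith
  have he0 : 0 < e := by
    rcases Nat.eq_zero_or_pos e with h | h
    · rw [h] at he
      have : 0 < 12 / (1 - β) := by positivity
      simp only [Nat.cast_zero] at he
      linarith
    · exact h
  have he' : 12 < e * (1 - β) := by rwa [div_lt_iff₀ hβ'] at he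
  refine ⟨e, he0, fun n => ?_⟩
  have hq := le_two_pow_logTwo n
  have hgap := two_mul_two_pow_threshold he0 n
  set s := threshold e n
  have ht : gapSize e n = (2 ^ logTwo (n + 2)) ^ e := rfl
  generalize 2 ^ logTwo (n + 2) = q at hq ht
  have hq2 : 2 ≤ q := by omega
  have hqt : q ≤ q ^ e := Nat.le_self_pow he0.ne' q
  have hm : 3 * (n + gapSize e n) ≤ q ^ (e + 3) := by
    have h8 : 2 ^ 3 ≤ q ^ 3 := Nat.pow_le_pow_left hq2 3
    calc 3 * (n + gapSize e n) ≤ q ^ e * 8 := by rw [ht]; omega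
      _ ≤ q ^ e * q ^ 3 := Nat.mul_le_mul_left _ (by simpa using h8)
      _ = q ^ (e + 3) := (pow_add ..).symm
  have hB : 18 * (n + 2) ^ 3 ≤ q ^ 8 := by
    have h32 : 2 ^ 5 ≤ q ^ 5 := Nat.pow_le_pow_left hq2 5
    calc 18 * (n + 2) ^ 3 ≤ q ^ 5 * q ^ 3 := Nat.mul_le_mul (by omega) (Nat.pow_le_pow_left hq 3)
      _ = q ^ 8 := (pow_add ..).symm
  have hqR : (2 : ℝ) ≤ q := by exact_mod_cast hq2
  have hq0 : (0 : ℝ) < q := by linarith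
  have hm1 : (1 : ℝ) ≤ ((3 * (n + gapSize e n) : ℕ) : ℝ) := by
    have := gapSize_pos e n
    exact_mod_cast (by omega : 1 ≤ 3 * (n + gapSize e n))
  have h₁ : ((3 * (n + gapSize e n) : ℕ) : ℝ) ^ α ≤ (q : ℝ) ^ ((e + 3 : ℝ) * β) := by
    calc ((3 * (n + gapSize e n) : ℕ) : ℝ) ^ α ≤ ((3 * (n + gapSize e n) : ℕ) : ℝ) ^ β :=
          Real.rpow_le_rpow_of_exponent_le hm1 hαβ
      _ ≤ ((q : ℝ) ^ (e + 3)) ^ β :=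
          Real.rpow_le_rpow (by linarith) (by exact_mod_cast hm) hβ0
      _ = (q : ℝ) ^ ((e + 3 : ℝ) * β) := by
          rw [← Real.rpow_natCast, ← Real.rpow_mul hq0.le]
          push_cast
          rfl
  have h₂ : ((18 * (n + 2) ^ 3 : ℕ) : ℝ) ≤ (q : ℝ) ^ (8 : ℝ) := by
    have : ((18 * (n + 2) ^ 3 : ℕ) : ℝ) ≤ ((q ^ 8 : ℕ) : ℝ) := by exact_mod_cast hB
    refine this.trans_eq ?_
    push_cast
    rw [← Real.rpow_natCast]
    norm_num
  have h₃ : (q : ℝ) ^ ((e : ℝ) - 1) ≤ 2 ^ s := by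
    have hg : (2 : ℝ) * 2 ^ s = (q : ℝ) ^ e := by
      rw [ht] at hgap
      exact_mod_cast hgap
    rw [Real.rpow_sub_one hq0.ne', Real.rpow_natCast, ← hg, div_le_iff₀ hq0]
    have : (0 : ℝ) < 2 ^ s := by positivity
    nlinarith
  calc ((3 * (n + gapSize e n) : ℕ) : ℝ) ^ α * (18 * (n + 2) ^ 3 : ℕ)
      ≤ (q : ℝ) ^ ((e + 3 : ℝ) * β) * (q : ℝ) ^ (8 : ℝ) :=
        mul_le_mul h₁ h₂ (by positivity) (by positivity)
    _ = (q : ℝ) ^ ((e + 3 : ℝ) * β + 8) := (Real.rpow_add hq0 _ _).symm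
    _ < (q : ℝ) ^ ((e : ℝ) - 1) :=
        Real.rpow_lt_rpow_of_exponent_lt (by linarith) (by nlinarith)
    _ ≤ 2 ^ s := h₃

theorem nonempty_iso_iff (I : GIInstance) : Nonempty (I.G ≃g I.G') ↔ I.n = I.n' ∧
    ∃ φ : Equiv.Perm (Fin I.n), ∀ i j : Fin I.n, adjNat I.G i j ↔ adjNat I.G' (φ i) (φ j) := by
  obtain ⟨n, G, n', G'⟩ := I
  constructor
  · rintro ⟨f⟩
    have : n = n' := by simpa using Fintype.card_congr f.toEquiv
    subst this
    refine ⟨rfl, f.toEquiv, fun i j => ?_⟩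
    dsimp only
    rw [adjNat_coe, adjNat_coe]
    exact f.map_adj_iff.symm
  · rintro ⟨h, φ, hφ⟩
    dsimp only at h
    subst h
    refine ⟨⟨φ, fun {i j} => ?_⟩⟩
    have := hφ i j
    rw [adjNat_coe, adjNat_coe] at this
    exact this.symm

section Main

variable {d : ∀ m : ℕ, PrefOrder (Fin m) m → PrefOrder (Fin m) m → ℕ}

/-- What an approximation tells about the reduction. -/
theorem approx_lt_iff {α : ℝ} {e : ℕ} (he : 0 < e)
    (hgap : ∀ n : ℕ, ((3 * (n + gapSize e n) : ℕ) : ℝ) ^ α * (18 * (n + 2) ^ 3 : ℕ) <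
      2 ^ threshold e n)
    (hd : ∀ m u v, spearDist u v ≤ 2 * d m u v)
    (hd' : ∀ m u v, d m u v ≤ 2 * (inversions u v).card)
    {I : GIInstance} (hI : I.n = I.n') {a : ℕ}
    (h₁ : isoDist (d (reduction e I).m) (reduction e I).E (reduction e I).E' ≤ a)
    (h₂ : (a : ℝ) ≤ ((reduction e I).m : ℝ) ^ α *
      (isoDist (d (reduction e I).m) (reduction e I).E (reduction e I).E' : ℝ)) :
    (∃ φ : Equiv.Perm (Fin I.n), ∀ i j : Fin I.n, adjNat I.G i j ↔ adjNat I.G' (φ i) (φ j)) ↔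
      a < 2 ^ threshold e I.n := by
  have gap := isoDist_graphElection (n := I.n) (t := gapSize e I.n) (A := adjNat I.G)
    (A' := adjNat I.G') (fun _ _ ⟨hi, hj, _⟩ => ⟨hi, hj⟩)
    (fun _ _ ⟨hi, hj, _⟩ => ⟨hI ▸ hi, hI ▸ hj⟩) (fun _ ⟨_, _, h⟩ => I.G.loopless.irrefl _ h)
    (fun _ ⟨_, _, h⟩ => I.G'.loopless.irrefl _ h) (d _) (hd _) (hd' _)
  change isoDist (d _) (graphElection I.n (gapSize e I.n) (adjNat I.G)) (graphElection I.n
    (gapSize e I.n) (adjNat I.G')) ≤ a at h₁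
  change (a : ℝ) ≤ ((3 * (I.n + gapSize e I.n) : ℕ) : ℝ) ^ α * (isoDist (d _) (graphElection I.n
    (gapSize e I.n) (adjNat I.G)) (graphElection I.n (gapSize e I.n) (adjNat I.G')) : ℕ) at h₂
  generalize isoDist (d _) (graphElection I.n (gapSize e I.n) (adjNat I.G)) (graphElection I.n
    (gapSize e I.n) (adjNat I.G')) = D at gap h₁ h₂
  constructor
  · intro h
    have : (a : ℝ) < 2 ^ threshold e I.n := by
      refine (h₂.trans (mul_le_mul_of_nonneg_left ?_ (by positivity))).trans_lt (hgap I.n)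
      exact_mod_cast gap.1 h
    exact_mod_cast this
  -- Without an isomorphism, `2 * 2 ^ threshold e I.n = gapSize e I.n` is at most twice the
  -- distance, so `a` reaches the threshold.
  · intro h
    by_contra hn
    have := gap.2 hn
    rw [← two_mul_two_pow_threshold he] at this
    omega

/-- A crude bound on the values of an approximation. -/
theorem approx_le {α : ℝ} (hα : α < 1)
    (hd' : ∀ m u v, d m u v ≤ 2 * (inversions u v).card) (J : IDInstance) {a : ℕ}
    (h₂ : (a : ℝ) ≤ (J.m : ℝ) ^ α * (isoDist (d J.m) J.E J.E' : ℝ)) :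
    a ≤ J.m * (J.n * (2 * (J.m * J.m))) := by
  have h₁ : isoDist (d J.m) J.E J.E' ≤ J.n * (2 * (J.m * J.m)) := by
    refine (isoDist_le _ _ _ 1 (Equiv.refl _)).trans ?_
    calc _ ≤ ∑ _i : Fin J.n, 2 * (J.m * J.m) := Finset.sum_le_sum fun i _ =>
          (hd' _ _ _).trans (Nat.mul_le_mul_left _ ((Finset.card_le_univ _).trans_eq (by simp)))
      _ = J.n * (2 * (J.m * J.m)) := by simp
  have hm : (1 : ℝ) ≤ J.m := by exact_mod_cast J.m_pos
  have h₃ : (J.m : ℝ) ^ α ≤ J.m := by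
    simpa using Real.rpow_le_rpow_of_exponent_le hm hα.le
  have : (a : ℝ) ≤ J.m * (J.n * (2 * (J.m * J.m)) : ℕ) :=
    h₂.trans (mul_le_mul h₃ (by exact_mod_cast h₁) (by positivity) (by linarith))
  exact_mod_cast this

/-- Isomorphism holds exactly when the orders agree and the oracle's binary answer on `reduction e
I` has at most `threshold e I.n` bits. -/
theorem graphIsomorphismInP_of_hasPolyTimeApprox {α : ℝ} (hα : α < 1)
    (hd : ∀ m u v, spearDist u v ≤ 2 * d m u v)
    (hd' : ∀ m u v, d m u v ≤ 2 * (inversions u v).card)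
    (h : HasPolyTimeApprox d fun c => (c : ℝ) ^ α) : GraphIsomorphismInP := by
  classical
  obtain ⟨A, ⟨T⟩, hA⟩ := h
  obtain ⟨e, he, hgap⟩ := exists_exponent hα
  let M : BitMachine := ⟨T.tm, T.inputAlphabet, T.outputAlphabet⟩
  have hM : ∀ J : IDInstance,
      M.Answers J.encode (encodeNat (A J)) (T.time.eval J.encode.length) :=
    fun J => ⟨T.outputsFun J⟩
  -- The approximate value is at most a polynomial in the numbers of candidates and voters; both are
  -- computable in unary, hence polynomially bounded, and `B < 2 ^ B` bounds the length by the
  -- value.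
  have hlen : PolyBd fun I : GIInstance => (encodeNat (A (reduction e I))).length := by
    have hm : PT M.Answers fun I : GIInstance => (reduction e I).m :=
      (PT.const 3).mul (pt_n.add (pt_gapSize e))
    have hn : PT M.Answers fun I : GIInstance => (reduction e I).n := pt_n.add (PT.const 2)
    refine (hm.mul (hn.mul ((PT.const 2).mul (hm.mul hm)))).polyBd.mono fun I => ?_
    rw [code_nat, List.length_replicate]
    refine le_trans ?_ (approx_le hα hd' (reduction e I) (hA _).2)
    rw [length_encodeNat_le_iff]
    exact Nat.lt_two_pow_self
  have hcall : PT M.Answers fun I : GIInstance => encodeNat (A (reduction e I)) :=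
    PT.call (pt_reduction e) (T := fun I => T.time.eval (code (reduction e I)).length)
      (PolyBd.eval T.time (pt_reduction (R := M.Answers) e).polyBd) hlen
      fun I => hM (reduction e I)
  have hthr : PT M.Answers fun I : GIInstance => threshold e I.n :=
    ((PT.logTwo (pt_n.add (PT.const 2))).mul (PT.const e)).sub (PT.const 1)
  have hdec : PD M.Answers fun I : GIInstance => Nonempty (I.G ≃g I.G') := by
    refine ((PD.eq pt_n pt_n').and (PD.le hcall.length hthr)).congr fun I => ?_
    rw [nonempty_iso_iff]
    refine and_congr_right fun hI => ?_
    rw [length_encodeNat_le_iff]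
    exact approx_lt_iff he hgap hd hd' hI (hA _).1 (hA _).2
  refine PT.computableInPolyTime M ((PT.ite hdec (PT.const [true]) (PT.const [false])).congr_code
    fun I => ?_)
  by_cases hI : Nonempty (I.G ≃g I.G')
  · simp only [hI, decide_true, if_true]; rfl
  · simp only [hI, decide_false, if_false]; rfl

end Main

end ElectionIso

end

theorem mainTheorem3 (α : ℝ) (hα : α < 1) (hGI : ¬ ElectionIso.GraphIsomorphismInP) :
    (¬ ElectionIso.HasPolyTimeApprox (fun _ u v => ElectionIso.spearDist u v)
        (fun c => (c : ℝ) ^ α)) ∧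
    (¬ ElectionIso.HasPolyTimeApprox (fun _ u v => ElectionIso.swapDist u v)
        (fun c => (c : ℝ) ^ α)) := by
  have swap_le : ∀ (m : ℕ) (u v : ElectionIso.PrefOrder (Fin m) m),
      ElectionIso.swapDist u v ≤ (ElectionIso.inversions u v).card :=
    fun _ => ElectionIso.swapDist_le_card_inversions
  have spear_le : ∀ (m : ℕ) (u v : ElectionIso.PrefOrder (Fin m) m),
      ElectionIso.spearDist u v ≤ 2 * ElectionIso.swapDist u v :=
    fun _ => ElectionIso.spearDist_le_two_mul_swapDist
  refine ⟨fun h => hGI (ElectionIso.graphIsomorphismInP_of_hasPolyTimeApprox hα ?_ ?_ h),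
    fun h => hGI (ElectionIso.graphIsomorphismInP_of_hasPolyTimeApprox hα spear_le ?_ h)⟩
  · intro m u v
    exact Nat.le_mul_of_pos_left _ two_pos
  · intro m u v
    exact (spear_le m u v).trans (Nat.mul_le_mul_left 2 (swap_le m u v))
  · intro m u v
    exact (swap_le m u v).trans (Nat.le_mul_of_pos_left _ two_pos)
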